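/- Let $-\infty\le a<b\le\infty$ and let $[a,b]$ denote the set of real $x$ with $a\le x\le b$. Let $w\ge 0$ be a weight on $[a,b]$, i.e. $\int_a^b|x|^n w(x)\,dx<\infty$ for all $n\ge 0$ and $\int_a^b w(x)\,dx>0$. Let $N$ be even, and let $f$ be a (real- or complex-valued) Schwartz function on $\mathbb{R}$ with $f(a)=f(b)$, where $f(\pm\infty):=0$ (no condition if $[a,b]=\mathbb{R}$; in particular this holds if $f$ vanishes at the finite endpoints). Put $$G_N^{(1)}(f)=\frac{\int_{[a,b]^N}\prod_{1\le j<k\le N}|x_j-x_k|\prod_{j=1}^N w(x_j)\,[1+f(x_j)]\,dx_1\cdots dx_N}{\int_{[a,b]^N}\prod_{1\le j<k\le N}|x_j-x_k|\prod_{j=1}^N w(x_j)\,dx_1\cdots dx_N}.$$ Let $\varepsilon$ be the integral operator on $[a,b]$ with kernel $\varepsilon(x,y)=\tfrac12\operatorname{sgn}(x-y)$. For $j=0,\dots,N-1$ let $\pi_j$ be an arbitrary polynomial of degree exactly $j$, with coefficients in the field where $f$ takes its values, and let $\psi_j(x)=\pi_j(x)w(x)$. Let $$M=\left(\int_a^b\psi_j(x)\,\varepsilon\psi_k(x)\,dx\right)_{j,k=0}^{N-1}.$$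 Then the two integrals defining $G_N^{(1)}(f)$ converge absolutely, the one in the denominator is positive, and $M$ is invertible. Moreover, with $M^{-1}=(\mu_{jk})_{j,k=0}^{N-1}$ and with $K$ the integral operator on $[a,b]$ with kernel $$K(x,y)=\sum_{j,k=0}^{N-1}\mu_{jk}\,\varepsilon\psi_j(x)\,\psi_k(y),$$ one has $$\left[G_N^{(1)}(f)\right]^2=\det\left(I+K(f^2+2f)-K\varepsilon f'-Kf\varepsilon f'\right).$$ Here functions stand for multiplication operators, products of integral operators have the composed kernels, and $\det(I+T)$ is the Fredholm determinant of the integral operator $T$ on $[a,b]$ with kernel $T(x,y)$, i.e. the sum of the convergent Fredholm series $\sum_{n\ge0}\frac1{n!}\int_{[a,b]^n}\det\left(T(x_i,x_j)\right)_{i,j=1}^n dx_1\cdots dx_n$ with absolutely convergent integrals. -/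

import Mathlib

noncomputable section

namespace OrthogonalEnsemble

open MeasureTheory

variable {𝕜 : Type*} [RCLike 𝕜]

/-- The real interval `[a, b]`, where `a = -∞` and `b = +∞` are allowed. -/
def interval (a b : EReal) : Set ℝ := {x : ℝ | a ≤ (x : EReal) ∧ (x : EReal) ≤ b}

/-- The value at an endpoint of a function that decays at infinity: `f e` for a finite `e`,
and the limit `0` for `e = ±∞`. -/
def endValue (f : ℝ → 𝕜) (e : EReal) : 𝕜 := if e = ⊥ ∨ e = ⊤ then 0 else f e.toReal

/-- `w` is a weight on `I`: nonnegative, not almost everywhere zero, with finite moments. -/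
structure IsWeight (I : Set ℝ) (w : ℝ → ℝ) : Prop where
  nonneg : ∀ x ∈ I, 0 ≤ w x
  moments : ∀ n : ℕ, IntegrableOn (fun x => x ^ n * w x) I
  pos : 0 < ∫ x in I, w x

/-- The cube `I ^ n`. -/
def cube (I : Set ℝ) (n : ℕ) : Set (Fin n → ℝ) := Set.univ.pi fun _ => I

/-- The unnormalised joint density `∏_{j<k} |x_j - x_k| ∏_j w(x_j)` for `β = 1`. -/
def density (w : ℝ → ℝ) (N : ℕ) (x : Fin N → ℝ) : ℝ :=
  (∏ j : Fin N, ∏ k ∈ Finset.Ioi j, |x j - x k|) * ∏ j : Fin N, w (x j)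

/-- The normalisation integral; its inverse is the constant `C_N`. -/
def partitionFunction (I : Set ℝ) (w : ℝ → ℝ) (N : ℕ) : ℝ :=
  ∫ x in cube I N, density w N x

/-- The integrand of the generating function. -/
def genIntegrand (w : ℝ → ℝ) (N : ℕ) (f : ℝ → 𝕜) (x : Fin N → ℝ) : 𝕜 :=
  (density w N x : 𝕜) * ∏ j : Fin N, (1 + f (x j))

/-- The generating function `G_N(f)` of the orthogonal ensemble. -/
def genFun (I : Set ℝ) (w : ℝ → ℝ) (N : ℕ) (f : ℝ → 𝕜) : 𝕜 :=
  ((partitionFunction I w N : ℝ) : 𝕜)⁻¹ * ∫ x in cube I N, genIntegrand w N f x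

/-- The kernel `ε(x, y) = sgn(x - y) / 2`. -/
def epsKernel (x y : ℝ) : 𝕜 := ((Real.sign (x - y) / 2 : ℝ) : 𝕜)

/-- The action of `ε` on functions on `I`. -/
def eps (I : Set ℝ) (g : ℝ → 𝕜) (x : ℝ) : 𝕜 := ∫ t in I, epsKernel x t * g t

/-- `ψ_j = π_j w`. -/
def psi {N : ℕ} (w : ℝ → ℝ) (p : Fin N → Polynomial 𝕜) (j : Fin N) (x : ℝ) : 𝕜 :=
  (p j).eval (x : 𝕜) * (w x : 𝕜)

/-- The matrix `M = (∫ ψ_j εψ_k)`. -/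
def momentMatrix {N : ℕ} (I : Set ℝ) (w : ℝ → ℝ) (p : Fin N → Polynomial 𝕜) :
    Matrix (Fin N) (Fin N) 𝕜 :=
  Matrix.of fun j k => ∫ x in I, psi w p j x * eps I (psi w p k) x

/-- The kernel `∑ μ_{jk} εψ_j(x) ψ_k(y)`, where `(μ_{jk}) = M⁻¹`. -/
def kernel22 {N : ℕ} (I : Set ℝ) (w : ℝ → ℝ) (p : Fin N → Polynomial 𝕜) (x y : ℝ) : 𝕜 :=
  ∑ j : Fin N, ∑ k : Fin N,
    (momentMatrix I w p)⁻¹ j k * eps I (psi w p j) x * psi w p k y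

/-- Kernel of the product `A B` of two integral operators on `I`. -/
def kernelComp (I : Set ℝ) (A B : ℝ → ℝ → 𝕜) (x y : ℝ) : 𝕜 := ∫ z in I, A x z * B z y

/-- Kernel of `A h`, the operator `A` after multiplication by the function `h`. -/
def kernelMul (A : ℝ → ℝ → 𝕜) (h : ℝ → 𝕜) (x y : ℝ) : 𝕜 := A x y * h y

/-- Kernel of the operator `K (f² + 2f) - K ε f' - K f ε f'`. -/
def scalarKernel (I : Set ℝ) (K : ℝ → ℝ → 𝕜) (f : ℝ → 𝕜) (x y : ℝ) : 𝕜 :=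
  kernelMul K (fun t => f t ^ 2 + 2 * f t) x y
    - kernelMul (kernelComp I K epsKernel) (deriv f) x y
    - kernelMul (kernelComp I (kernelMul K f) epsKernel) (deriv f) x y

/-- `d` is the Fredholm determinant `det (I + T)` of the integral operator on `I` with kernel
`T`, that is, the sum of the Fredholm series
`∑ₙ (1 / n!) ∫_{Iⁿ} det (T(x_i, x_j)) dx₁ ⋯ dxₙ`, all of whose terms are integrable. -/
def IsFredholmDet (I : Set ℝ) (T : ℝ → ℝ → 𝕜) (d : 𝕜) : Prop :=
  (∀ n : ℕ, IntegrableOn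
    (fun x : Fin n → ℝ => (Matrix.of fun i j => T (x i) (x j)).det) (cube I n)) ∧
  HasSum (fun n : ℕ => (n.factorial : 𝕜)⁻¹ *
    ∫ x in cube I n, (Matrix.of fun i j => T (x i) (x j)).det) d

end OrthogonalEnsemble

end

/-!
For an even number of points the product `∏_{j<k} sgn(x_k - x_j)` is, up to a constant, the Pfaffian
of `ε(x_j, x_k)`. Hence `|Δ(x)|` is a constant times `Δ(x)` times a Pfaffian, and integrating this
term by term against `∏ u(x_j)` (de Bruijn) gives the Pfaffian of the matrix of the pairings
`∫ (π_j u) ε(π_k u)`, whose square is a determinant. Taking `u = w` and `u = w (1 + f)` yields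
`G² = (det M)⁻¹ det (∫ ψ_j (1 + f) ε(ψ_k (1 + f)))`.

Since `f(a) = f(b)`, the function `f'` has mean zero on `[a, b]`, and integration gives the
commutator identity `f ε - ε f = ε f' ε`. By means of it the matrix in the numerator becomes
`M + (∫ r_j εψ_k)` with `r_j = (f² + 2 f) ψ_j + f' εψ_j + f' ε(f ψ_j)`. Now
`det (I + M⁻¹ (∫ r_j εψ_k))` is the Fredholm determinant of the finite-rank operator with kernel
`∑ μ_{jk} εψ_j(x) r_k(y)`, which by antisymmetry of `ε` is `K (f² + 2 f) - K ε f' - K f ε f'`.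
-/

namespace OrthogonalEnsemble

section PfaffianSum

open Matrix Equiv Finset

theorem sum_perm_eq_sum_fun {ι M : Type*} [Fintype ι] [DecidableEq ι] [AddCommMonoid M]
    {F : (ι → ι) → M} (hF : ∀ p, ¬ Function.Injective p → F p = 0) :
    ∑ σ : Perm ι, F σ = ∑ p, F p :=
  Fintype.sum_of_injective (fun σ : Perm ι => ⇑σ) DFunLike.coe_injective _ _
    (fun p hp => hF p fun h => hp ⟨ofBijective p (Finite.injective_iff_bijective.1 h), rfl⟩)
    fun _ => rfl

variable {ι α R : Type*} [Fintype ι] [DecidableEq ι] [DecidableEq α] [CommRing R]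

theorem permMatrix_mul_mul_transpose (σ : Perm ι) (A : Matrix ι ι R) :
    σ.permMatrix R * A * (σ.permMatrix R)ᵀ = A.submatrix σ σ := by
  rw [transpose_permMatrix, PEquiv.toMatrix_toPEquiv_mul, PEquiv.mul_toMatrix_toPEquiv]
  rfl

theorem J_apply_of_ne_swap {k l : α ⊕ α} (h : l ≠ k.swap) : J α R k l = 0 := by
  rcases k with a | a <;> rcases l with b | b <;> simp_all [J, eq_comm]

theorem J_apply_swap_sq (k : α ⊕ α) : J α R k k.swap * J α R k k.swap = 1 := by
  rcases k with a | a <;> simp [J]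

variable [Fintype α]

/-- For a skew-symmetric matrix, `2 ^ n * n!` times its Pfaffian, where `n = |α|`: the sum runs over
all permutations instead of over the perfect matchings. Indexing the matrix by `α ⊕ α` provides the
reference matching `{inl a, inr a}`. -/
def pfaffianSum (A : Matrix (α ⊕ α) (α ⊕ α) R) : R :=
  ∑ σ : Perm (α ⊕ α), ((Perm.sign σ : ℤ) : R) * ∏ a, A (σ (.inl a)) (σ (.inr a))

theorem prod_conj_apply (A B : Matrix (α ⊕ α) (α ⊕ α) R) (q : α ⊕ α → α ⊕ α) :
    ∏ a, (B * A * Bᵀ) (q (.inl a)) (q (.inr a)) =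
      ∑ p : α ⊕ α → α ⊕ α, (∏ k, B (q k) (p k)) * ∏ a, A (p (.inl a)) (p (.inr a)) := by
  have entry (a : α) : (B * A * Bᵀ) (q (.inl a)) (q (.inr a)) =
      ∑ k : (α ⊕ α) × (α ⊕ α), B (q (.inl a)) k.1 * B (q (.inr a)) k.2 * A k.1 k.2 := by
    rw [Fintype.sum_prod_type_right]
    simp only [mul_apply, transpose_apply, sum_mul]
    exact sum_congr rfl fun l _ => sum_congr rfl fun k _ => by ring
  simp_rw [entry]
  rw [prod_univ_sum, Fintype.piFinset_univ]
  let e : (α → (α ⊕ α) × (α ⊕ α)) ≃ (α ⊕ α → α ⊕ α) :=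
    (arrowProdEquivProdArrow α _ _).trans (sumArrowEquivProdArrow α α _).symm
  refine Fintype.sum_equiv e _ _ fun k => ?_
  rw [Fintype.prod_sum_type, ← prod_mul_distrib, ← prod_mul_distrib]
  rfl

theorem pfaffianSum_conj (A B : Matrix (α ⊕ α) (α ⊕ α) R) :
    pfaffianSum (B * A * Bᵀ) = B.det * pfaffianSum A := by
  calc pfaffianSum (B * A * Bᵀ)
    _ = ∑ p : α ⊕ α → α ⊕ α, (B.submatrix id p).det * ∏ a, A (p (.inl a)) (p (.inr a)) := by
      simp_rw [pfaffianSum, prod_conj_apply, mul_sum, det_apply', sum_mul]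
      rw [sum_comm]
      simp only [submatrix_apply, id, mul_assoc]
    _ = ∑ τ : Perm (α ⊕ α), (B.submatrix id τ).det * ∏ a, A (τ (.inl a)) (τ (.inr a)) := by
      refine (sum_perm_eq_sum_fun fun p hp => ?_).symm
      obtain ⟨i, j, hij, hne⟩ := Function.not_injective_iff.1 hp
      rw [det_zero_of_column_eq hne fun k => by simp [hij], zero_mul]
    _ = B.det * pfaffianSum A := by
      rw [pfaffianSum, mul_sum]
      exact sum_congr rfl fun τ _ => by rw [det_permute' τ B]; ring

theorem pfaffianSum_submatrix_perm (A : Matrix (α ⊕ α) (α ⊕ α) R) (τ : Perm (α ⊕ α)) :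
    pfaffianSum (A.submatrix τ τ) = ((Perm.sign τ : ℤ) : R) * pfaffianSum A := by
  have h := pfaffianSum_conj A (τ.permMatrix R)
  rwa [permMatrix_mul_mul_transpose, det_permutation] at h

theorem pfaffianSum_eq_zero_of_row_eq_zero {A : Matrix (α ⊕ α) (α ⊕ α) R} {i : α ⊕ α}
    (hrow : ∀ j, A i j = 0) (hcol : ∀ j, A j i = 0) : pfaffianSum A = 0 := by
  refine sum_eq_zero fun σ _ => mul_eq_zero_of_right _ ?_
  rcases h : σ.symm i with a | a
  · exact prod_eq_zero (mem_univ a) (by rw [← h, apply_symm_apply, hrow])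
  · exact prod_eq_zero (mem_univ a) (by rw [← h, apply_symm_apply, hcol])

theorem det_J : (J α R).det = 1 :=
  SymplecticGroup.det_eq_one (SymplecticGroup.J_mem α R)

theorem sign_mul_prod_eq_one_of_symplectic {σ : Perm (α ⊕ α)} {d : α ⊕ α → R}
    (h : ∀ k l, d k * J α R (σ k) (σ l) * d l = J α R k l) :
    ((Perm.sign σ : ℤ) : R) * ∏ k, d k = 1 := by
  have hmem : diagonal d * σ.permMatrix R ∈ symplecticGroup α R := by
    rw [SymplecticGroup.mem_iff, transpose_mul, diagonal_transpose, ← Matrix.mul_assoc,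
      Matrix.mul_assoc (diagonal d), Matrix.mul_assoc (diagonal d), permMatrix_mul_mul_transpose]
    ext k l
    rw [mul_diagonal, diagonal_mul, submatrix_apply, h]
  have hdet := SymplecticGroup.det_eq_one hmem
  rwa [det_mul, det_diagonal, det_permutation, mul_comm] at hdet

theorem sign_mul_prod_J {σ : Perm (α ⊕ α)} (hσ : ∀ a, σ (.inr a) = (σ (.inl a)).swap) :
    ((Perm.sign σ : ℤ) : R) * ∏ a, J α R (σ (.inl a)) (σ (.inr a)) = (-1) ^ Fintype.card α := by
  let d : α ⊕ α → R := Sum.elim 1 fun a => -J α R (σ (.inl a)) (σ (.inr a))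
  have hswap (k : α ⊕ α) : σ k.swap = (σ k).swap := by rcases k with a | a <;> simp [hσ]
  have hskew (k l : α ⊕ α) : J α R l k = -J α R k l := congrFun₂ (J_transpose α R) k l
  have hsymp (k l : α ⊕ α) : d k * J α R (σ k) (σ l) * d l = J α R k l := by
    by_cases h : l = k.swap
    · subst h
      rcases k with a | a
      · have hJ : J α R (.inl a) (.inr a) = -1 := by simp [J]
        simp [d, hσ, J_apply_swap_sq, hJ]
      · have hJ : J α R (.inr a) (.inl a) = 1 := by simp [J]
        simp [d, hskew (σ (.inl a)), hσ, J_apply_swap_sq, hJ]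
    · rw [J_apply_of_ne_swap h, J_apply_of_ne_swap fun h' => h (σ.injective (by rw [h', hswap]))]
      simp
  have h := sign_mul_prod_eq_one_of_symplectic hsymp
  simp only [d, Fintype.prod_sum_type, Sum.elim_inl, Sum.elim_inr, Pi.one_apply, prod_const_one,
    one_mul, prod_neg, card_univ] at h
  have hsq : ((-1 : R) ^ Fintype.card α) * (-1) ^ Fintype.card α = 1 := by simp [← mul_pow]
  linear_combination (-1) ^ Fintype.card α * h -
    (((Perm.sign σ : ℤ) : R) * ∏ a, J α R (σ (.inl a)) (σ (.inr a))) * hsq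

theorem pfaffianSum_J_ne_zero [IsDomain R] [CharZero R] : pfaffianSum (J α R) ≠ 0 := by
  have h : pfaffianSum (J α R) =
      ∑ σ : Perm (α ⊕ α) with ∀ a, σ (.inr a) = (σ (.inl a)).swap, (-1) ^ Fintype.card α := by
    rw [pfaffianSum, sum_filter]
    refine sum_congr rfl fun σ _ => ?_
    split_ifs with hσ
    · exact sign_mul_prod_J hσ
    · obtain ⟨a, ha⟩ := not_forall.1 hσ
      rw [prod_eq_zero (mem_univ a) (J_apply_of_ne_swap ha), mul_zero]
  rw [h, sum_const, nsmul_eq_mul]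
  exact mul_ne_zero (Nat.cast_ne_zero.2 (card_ne_zero.2 ⟨1, by simp⟩)) (by simp)

end PfaffianSum

section SymplecticBasis

open Matrix Finset LinearMap

variable {K V : Type*} [Field K] [AddCommGroup V] [Module K V] {ω : LinearMap.BilinForm K V}

theorem exists_ne_zero_forall_apply_eq_zero [FiniteDimensional K V] {ι : Type*} [Fintype ι]
    (b : ι → V) (h : Fintype.card ι < Module.finrank K V) :
    ∃ v ≠ 0, ∀ k, ω (b k) v = 0 := by
  have hker : (LinearMap.pi fun k => ω (b k)).ker ≠ ⊥ :=
    ker_ne_bot_of_finrank_lt (by simpa using h)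
  obtain ⟨v, hv, hv0⟩ := Submodule.exists_mem_ne_zero_of_ne_bot hker
  exact ⟨v, hv0, congrFun (LinearMap.mem_ker.1 hv)⟩

theorem exists_orthogonal_of_apply_eq_J {α : Type*} [Finite α] [DecidableEq α]
    (hω : ω.IsAlt) {b : α ⊕ α → V} (hb : ∀ k l, ω (b k) (b l) = J α K k l) {v : V}
    (hv : ∀ k, ω (b k) v = 0) (u₀ : V) : ∃ u, (∀ k, ω (b k) u = 0) ∧ ω v u = ω v u₀ := by
  cases nonempty_fintype α
  have hv' (k) : ω v (b k) = 0 := hω.isRefl _ _ (hv k)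
  refine ⟨u₀ + ∑ a, (ω (b (.inl a)) u₀ • b (.inr a) - ω (b (.inr a)) u₀ • b (.inl a)),
    fun k => ?_, by simp [hv']⟩
  rcases k with k | k <;> simp [hb, J, Matrix.one_apply]

theorem apply_cons_eq_J (hω : ω.IsAlt) {m : ℕ} {b : Fin m ⊕ Fin m → V}
    (hb : ∀ k l, ω (b k) (b l) = J (Fin m) K k l) {v u : V} (hv : ∀ k, ω (b k) v = 0)
    (hu : ∀ k, ω (b k) u = 0) (hvu : ω v u = -1) (k l : Fin (m + 1) ⊕ Fin (m + 1)) :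
    let b' : Fin (m + 1) ⊕ Fin (m + 1) → V :=
      Sum.elim (Fin.cons v fun a => b (.inl a)) (Fin.cons u fun a => b (.inr a))
    ω (b' k) (b' l) = J (Fin (m + 1)) K k l := by
  have huv : ω u v = 1 := by rw [← hω.neg_eq, hvu, neg_neg]
  have hv' (k) : ω v (b k) = 0 := hω.isRefl _ _ (hv k)
  have hu' (k) : ω u (b k) = 0 := hω.isRefl _ _ (hu k)
  have hself := hω.self_eq_zero
  rcases k with k | k <;> rcases l with l | l <;> cases k using Fin.cases <;>
    cases l using Fin.cases <;>
    simp [hself, hvu, huv, hv, hv', hu, hu', hb, J, Matrix.one_apply, (Fin.succ_ne_zero _).symm]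

theorem exists_apply_eq_J [FiniteDimensional K V] (hω : ω.IsAlt) (hnd : ω.Nondegenerate) {m : ℕ}
    (hm : m + m ≤ Module.finrank K V) :
    ∃ b : Fin m ⊕ Fin m → V, ∀ k l, ω (b k) (b l) = J (Fin m) K k l := by
  induction m with
  | zero => exact ⟨fun _ => 0, fun k => by rcases k with k | k <;> exact k.elim0⟩
  | succ m ih =>
    obtain ⟨b, hb⟩ := ih (by lia)
    obtain ⟨v, hv0, hv⟩ := exists_ne_zero_forall_apply_eq_zero (ω := ω) b (by simp; lia)
    obtain ⟨u₀, hu₀⟩ : ∃ u₀, ω v u₀ ≠ 0 := by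
      by_contra! h
      exact hv0 (hnd.1 v h)
    obtain ⟨u, hu, hvu⟩ := exists_orthogonal_of_apply_eq_J hω hb hv u₀
    have hvu' : ω ((-(ω v u₀)⁻¹) • v) u = -1 := by simp [hvu, hu₀]
    exact ⟨_, apply_cons_eq_J hω hb (fun k => by simp [hv k]) hu hvu'⟩

end SymplecticBasis

section PfaffianSq

open Matrix

variable {ι α K : Type*} [Fintype ι] [DecidableEq ι] [Fintype α] [DecidableEq α] [Field K]

theorem isAlt_toBilin' [NeZero (2 : K)] {A : Matrix ι ι K} (hA : Aᵀ = -A) :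
    (toBilin' A).IsAlt := by
  intro x
  have h : x ⬝ᵥ A *ᵥ x = -(x ⬝ᵥ A *ᵥ x) := by
    conv_lhs => rw [dotProduct_mulVec, ← mulVec_transpose, hA, neg_mulVec, neg_dotProduct,
      dotProduct_comm]
  rw [toBilin'_apply']
  exact (mul_eq_zero.1 (by linear_combination h : 2 * (x ⬝ᵥ A *ᵥ x) = 0)).resolve_left two_ne_zero

theorem exists_conj_eq_J [NeZero (2 : K)] {n : ℕ} {A : Matrix (Fin n ⊕ Fin n) (Fin n ⊕ Fin n) K}
    (hA : Aᵀ = -A) (hdet : A.det ≠ 0) : ∃ B, B * A * Bᵀ = J (Fin n) K := by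
  obtain ⟨b, hb⟩ := exists_apply_eq_J (isAlt_toBilin' hA)
    (LinearMap.BilinForm.nondegenerate_toBilin'_of_det_ne_zero' A hdet) (m := n) (by simp)
  refine ⟨of b, ?_⟩
  ext k l
  rw [← hb, toBilin'_apply', dotProduct_mulVec]
  rfl

theorem det_one_updateRow (i : ι) (v : ι → K) : ((1 : Matrix ι ι K).updateRow i v).det = v i := by
  rw [← cramer_transpose_apply, transpose_one, cramer_one]
  rfl

theorem pfaffianSum_eq_zero_of_det_eq_zero {A : Matrix (α ⊕ α) (α ⊕ α) K} (hA : Aᵀ = -A)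
    (hdet : A.det = 0) : pfaffianSum A = 0 := by
  obtain ⟨v, hv0, hv⟩ := exists_vecMul_eq_zero_iff.2 hdet
  obtain ⟨i, hi⟩ := Function.ne_iff.1 hv0
  let B : Matrix (α ⊕ α) (α ⊕ α) K := (1 : Matrix (α ⊕ α) (α ⊕ α) K).updateRow i v
  have hBi : B i = v := by simp [B]
  have hrow (j) : (B * A * Bᵀ) i j = 0 := by
    have : (B * A) i = 0 := by rw [mul_apply_eq_vecMul, hBi, hv]
    simp [mul_apply (M := B * A), this]
  have hskew : (B * A * Bᵀ)ᵀ = -(B * A * Bᵀ) := by simp [transpose_mul, hA, Matrix.mul_assoc]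
  have hcol (j) : (B * A * Bᵀ) j i = 0 := by
    rw [← transpose_apply (B * A * Bᵀ), hskew, Matrix.neg_apply, hrow, neg_zero]
  have h := pfaffianSum_eq_zero_of_row_eq_zero hrow hcol
  rw [pfaffianSum_conj, det_one_updateRow] at h
  exact (mul_eq_zero.1 h).resolve_left hi

theorem pfaffianSum_sq [NeZero (2 : K)] {n : ℕ} {A : Matrix (Fin n ⊕ Fin n) (Fin n ⊕ Fin n) K}
    (hA : Aᵀ = -A) : pfaffianSum A ^ 2 = pfaffianSum (J (Fin n) K) ^ 2 * A.det := by
  by_cases hdet : A.det = 0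
  · rw [hdet, pfaffianSum_eq_zero_of_det_eq_zero hA hdet]
    simp
  obtain ⟨B, hB⟩ := exists_conj_eq_J hA hdet
  have hdetB : B.det * A.det * B.det = 1 := by
    rw [← det_J (α := Fin n) (R := K), ← hB, det_mul, det_mul, det_transpose]
  rw [← hB, pfaffianSum_conj]
  linear_combination (-pfaffianSum A ^ 2) * hdetB

end PfaffianSq

section OrderMatrix

open Matrix Equiv Finset

theorem odd_det_of_even_diag_of_odd_off_diag {ι : Type*} [Fintype ι] [DecidableEq ι]
    (hι : Even (Fintype.card ι)) {Z : Matrix ι ι ℤ} (hdiag : ∀ i, Even (Z i i))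
    (hoff : ∀ i j, i ≠ j → Odd (Z i j)) : Odd Z.det := by
  have hZ : Z.map (Int.castRingHom (ZMod 2)) =
      1 + replicateCol Unit (1 : ι → ZMod 2) * replicateRow Unit (1 : ι → ZMod 2) := by
    ext i j
    by_cases h : i = j
    · subst h
      simpa [mul_apply] using ((hdiag i).intCast_zmod_two).trans (by decide : (0 : ZMod 2) = 1 + 1)
    · simpa [mul_apply, h] using (hoff i j h).intCast_zmod_two
  have hcard : (Fintype.card ι : ZMod 2) = 0 := ZMod.natCast_eq_zero_iff_even.2 hι
  rw [← ZMod.intCast_eq_one_iff_odd, ← eq_intCast (Int.castRingHom (ZMod 2)), RingHom.map_det,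
    RingHom.mapMatrix_apply, hZ, det_one_add_replicateCol_mul_replicateRow]
  simp [dotProduct, hcard]

variable {𝕜 : Type*} [RCLike 𝕜]

theorem epsKernel_eq_neg_swap (x y : ℝ) : (epsKernel x y : 𝕜) = -epsKernel y x := by
  rw [epsKernel, epsKernel, ← neg_sub y x, Real.sign_neg, neg_div, RCLike.ofReal_neg]

theorem epsKernel_self (x : ℝ) : (epsKernel x x : 𝕜) = 0 := by
  simp [epsKernel]

theorem epsKernel_of_gt {x y : ℝ} (h : y < x) : (epsKernel x y : 𝕜) = 1 / 2 := by
  rw [epsKernel, Real.sign_of_pos (sub_pos.2 h), RCLike.ofReal_div, RCLike.ofReal_one,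
    RCLike.ofReal_ofNat]

theorem epsKernel_of_lt {x y : ℝ} (h : x < y) : (epsKernel x y : 𝕜) = -(1 / 2) := by
  rw [epsKernel_eq_neg_swap, epsKernel_of_gt h]

theorem epsKernel_comp_strictMono {N : ℕ} {x y : Fin N → ℝ} (hx : StrictMono x)
    (hy : StrictMono y) (i j : Fin N) : (epsKernel (x i) (x j) : 𝕜) = epsKernel (y i) (y j) := by
  rcases lt_trichotomy i j with h | rfl | h
  · rw [epsKernel_of_lt (hx h), epsKernel_of_lt (hy h)]
  · rw [epsKernel_self, epsKernel_self]
  · rw [epsKernel_of_gt (hx h), epsKernel_of_gt (hy h)]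

/-- The matrix of the kernel `ε` at `N` increasing points; it does not depend on the choice of the
points, which are taken to be `0, …, N - 1`. -/
noncomputable def orderMatrix (𝕜 : Type*) [RCLike 𝕜] (N : ℕ) : Matrix (Fin N) (Fin N) 𝕜 :=
  of fun i j => epsKernel (i : ℝ) (j : ℝ)

theorem orderMatrix_transpose (N : ℕ) : (orderMatrix 𝕜 N)ᵀ = -orderMatrix 𝕜 N := by
  ext i j
  exact epsKernel_eq_neg_swap _ _

theorem det_orderMatrix_ne_zero {N : ℕ} (hN : Even N) : (orderMatrix 𝕜 N).det ≠ 0 := by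
  let Z : Matrix (Fin N) (Fin N) ℤ := of fun i j => Int.sign ((i : ℤ) - j)
  have hZ : orderMatrix 𝕜 N = (1 / 2 : 𝕜) • Z.map (Int.castRingHom 𝕜) := by
    ext i j
    have hij : ((i : ℕ) : ℝ) - ((j : ℕ) : ℝ) = (((i : ℤ) - j : ℤ) : ℝ) := by push_cast; rfl
    simp only [orderMatrix, of_apply, epsKernel, hij, Real.sign_intCast,
      RCLike.ofReal_div, RCLike.ofReal_ofNat]
    simp [Z, div_eq_inv_mul]
  have hodd : Odd Z.det := by
    refine odd_det_of_even_diag_of_odd_off_diag (by simpa using hN) (fun i => by simp [Z])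
      fun i j hij => ?_
    rcases lt_or_gt_of_ne hij with h | h
    · rw [show Z i j = -1 from Int.sign_eq_neg_one_of_neg (by rw [Fin.lt_def] at h; lia)]
      decide
    · rw [show Z i j = 1 from Int.sign_eq_one_of_pos (by rw [Fin.lt_def] at h; lia)]
      decide
  rw [hZ, det_smul, ← RingHom.mapMatrix_apply, ← RingHom.map_det]
  refine mul_ne_zero (pow_ne_zero _ (by simp)) ?_
  rw [Int.coe_castRingHom, Int.cast_ne_zero]
  intro h
  simp [h] at hodd

/-- The value of the Pfaffian sum of the kernel `ε` at `2n` increasing points. -/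
noncomputable def orderPfaffian (𝕜 : Type*) [RCLike 𝕜] (n : ℕ) : 𝕜 :=
  pfaffianSum ((orderMatrix 𝕜 (n + n)).submatrix finSumFinEquiv finSumFinEquiv)

theorem orderPfaffian_ne_zero (n : ℕ) : orderPfaffian 𝕜 n ≠ 0 := by
  have hskew : ((orderMatrix 𝕜 (n + n)).submatrix finSumFinEquiv finSumFinEquiv)ᵀ =
      -(orderMatrix 𝕜 (n + n)).submatrix finSumFinEquiv finSumFinEquiv := by
    rw [transpose_submatrix, orderMatrix_transpose, submatrix_neg]
    rfl
  rw [← sq_eq_zero_iff.ne, orderPfaffian, pfaffianSum_sq hskew, det_submatrix_equiv_self]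
  exact mul_ne_zero (pow_ne_zero _ pfaffianSum_J_ne_zero) (det_orderMatrix_ne_zero ⟨n, rfl⟩)

end OrderMatrix

section Vandermonde

open Matrix Equiv Finset Polynomial

theorem det_vandermonde_comp_perm {R : Type*} [CommRing R] {N : ℕ} (x : Fin N → R)
    (τ : Perm (Fin N)) :
    (vandermonde fun i => x (τ i)).det = (Perm.sign τ : ℤ) * (vandermonde x).det := by
  rw [← det_permute]
  rfl

theorem det_vandermonde_pos {N : ℕ} {x : Fin N → ℝ} (hx : StrictMono x) :
    0 < (vandermonde x).det := by
  rw [det_vandermonde]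
  exact prod_pos fun i _ => prod_pos fun j hj => sub_pos.2 (hx (mem_Ioi.1 hj))

theorem prod_abs_sub_eq_abs_det_vandermonde {N : ℕ} (x : Fin N → ℝ) :
    ∏ j : Fin N, ∏ k ∈ Ioi j, |x j - x k| = |(vandermonde x).det| := by
  rw [det_vandermonde, abs_prod]
  simp_rw [abs_prod, abs_sub_comm]

variable {𝕜 : Type*} [RCLike 𝕜]

theorem det_vandermonde_mul_pfaffianSum_epsKernel {n : ℕ} (x : Fin (n + n) → ℝ) :
    ((vandermonde x).det : 𝕜) * pfaffianSum (of fun k l : Fin n ⊕ Fin n =>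
      (epsKernel (x (finSumFinEquiv k)) (x (finSumFinEquiv l)) : 𝕜)) =
    orderPfaffian 𝕜 n * ((|(vandermonde x).det| : ℝ) : 𝕜) := by
  by_cases hx : Function.Injective x
  swap
  · simp [not_ne_iff.1 (det_vandermonde_ne_zero_iff.not.2 hx)]
  let τ := Tuple.sort x
  have hmono : StrictMono fun i => x (τ i) :=
    (Tuple.monotone_sort x).strictMono_of_injective (hx.comp τ.injective)
  have hpf : orderPfaffian 𝕜 n = (Perm.sign τ : ℤ) * pfaffianSum (of fun k l : Fin n ⊕ Fin n =>
      (epsKernel (x (finSumFinEquiv k)) (x (finSumFinEquiv l)) : 𝕜)) := by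
    rw [← Perm.sign_permCongr finSumFinEquiv.symm τ, ← pfaffianSum_submatrix_perm, orderPfaffian]
    congr 1
    ext k l
    simpa [orderMatrix] using
      epsKernel_comp_strictMono (𝕜 := 𝕜) (x := fun i => ((i : ℕ) : ℝ))
        (fun i j h => Nat.cast_lt.2 h) hmono _ _
  have habs : |(vandermonde x).det| = (Perm.sign τ : ℤ) * (vandermonde x).det := by
    rw [← det_vandermonde_comp_perm, ← abs_of_pos (det_vandermonde_pos hmono),
      det_vandermonde_comp_perm, abs_mul]
    rcases Int.units_eq_one_or (Perm.sign τ) with h | h <;> simp [h]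
  rw [hpf, habs]
  rcases Int.units_eq_one_or (Perm.sign τ) with h | h <;> simp [h, mul_comm]

theorem det_eval_eq_det_vandermonde_mul_det_coeff {R : Type*} [CommRing R] {N : ℕ}
    {p : Fin N → R[X]} (hp : ∀ j, (p j).natDegree < N) (x : Fin N → R) :
    (of fun i j => (p j).eval (x i)).det =
      (vandermonde x).det * (of fun k j : Fin N => (p j).coeff k).det := by
  rw [← det_mul]
  congr 1
  ext i j
  simp [mul_apply, eval_eq_sum_range' (hp j), Finset.sum_range, vandermonde_apply, mul_comm]

variable {K : Type*} [Field K] {N : ℕ} {p : Fin N → K[X]}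

theorem det_coeff_ne_zero (hp : ∀ j, (p j).natDegree < N) (hli : LinearIndependent K p) :
    (of fun k j : Fin N => (p j).coeff k).det ≠ 0 := by
  classical
  have hcoeff : LinearIndependent K fun j => toFn N (p j) := by
    refine LinearIndependent.of_comp (ofFn N) ?_
    convert hli using 1
    exact funext fun j => ofFn_comp_toFn_eq_id_of_natDegree_lt (hp j)
  rw [← isUnit_iff_ne_zero, ← isUnit_iff_isUnit_det, ← linearIndependent_cols_iff_isUnit]
  exact hcoeff

theorem linearIndependent_of_degree_eq (hp : ∀ j : Fin N, (p j).degree = (j : ℕ)) :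
    LinearIndependent K p := by
  let S : Polynomial.Sequence K :=
    ⟨fun i => if h : i < N then p ⟨i, h⟩ else X ^ i, fun i => by split_ifs <;> simp [hp]⟩
  have hpS : p = S ∘ Fin.val := by
    ext1 j
    change p j = if h : (j : ℕ) < N then p ⟨j, h⟩ else X ^ (j : ℕ)
    rw [dif_pos j.2]
  rw [hpS]
  exact S.linearIndependent.comp _ Fin.val_injective

end Vandermonde

section DeBruijn

open MeasureTheory Matrix Equiv Finset

variable {𝕜 X : Type*} [RCLike 𝕜]

variable {α : Type*} [Fintype α]

theorem det_mul_prod_kernel_eq [DecidableEq α] (E : X → X → 𝕜) (φ : α ⊕ α → X → 𝕜)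
    (x : α ⊕ α → X) :
    (of fun i j => φ j (x i)).det * ∏ a, E (x (.inl a)) (x (.inr a)) =
      ∑ σ : Perm (α ⊕ α), ((Perm.sign σ : ℤ) : 𝕜) *
        ((∏ k, φ (σ k) (x k)) * ∏ a, E (x (.inl a)) (x (.inr a))) := by
  rw [← det_transpose, det_apply', sum_mul]
  exact sum_congr rfl fun σ _ => by simp [mul_assoc]

theorem det_mul_pfaffianSum_kernel_eq [DecidableEq α] (E : X → X → 𝕜) (φ : α ⊕ α → X → 𝕜)
    (x : α ⊕ α → X) :
    (of fun i j => φ j (x i)).det * pfaffianSum (of fun k l => E (x k) (x l)) =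
      ∑ τ : Perm (α ⊕ α), (of fun i j => φ j (x (τ i))).det *
        ∏ a, E (x (τ (.inl a))) (x (τ (.inr a))) := by
  rw [pfaffianSum, mul_sum]
  refine sum_congr rfl fun τ _ => ?_
  have hdet : (of fun i j => φ j (x (τ i))).det =
      (Perm.sign τ : ℤ) * (of fun i j => φ j (x i)).det :=
    det_permute τ (of fun i j => φ j (x i))
  rw [hdet]
  simp only [of_apply]
  ring

variable [MeasurableSpace X]

/-- The action of the integral operator with kernel `E` on functions on `(X, μ)`. -/
noncomputable def integralOp (μ : Measure X) (E : X → X → 𝕜) (g : X → 𝕜) (x : X) : 𝕜 :=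
  ∫ t, E x t * g t ∂μ

/-- The matrix of the bilinear form `(g, h) ↦ ∫ g · E h dμ` on the family `φ`, where `E h` is the
integral operator with kernel `E` applied to `h`. -/
noncomputable def gramMatrix {ι : Type*} (μ : Measure X) (E : X → X → 𝕜) (φ : ι → X → 𝕜) :
    Matrix ι ι 𝕜 :=
  of fun j k => ∫ x, φ j x * integralOp μ E (φ k) x ∂μ

variable {μ : Measure X} [SigmaFinite μ]

theorem measurePreserving_comp_equiv {ι ι' : Type*} [Fintype ι] [Fintype ι'] (e : ι ≃ ι') :
    MeasurePreserving (MeasurableEquiv.piCongrLeft (fun _ : ι' => X) e).symm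
      (Measure.pi fun _ : ι' => μ) (Measure.pi fun _ : ι => μ) :=
  (measurePreserving_piCongrLeft (fun _ : ι' => μ) e).symm

theorem integral_comp_equiv {ι ι' : Type*} [Fintype ι] [Fintype ι'] (e : ι ≃ ι')
    (F : (ι → X) → 𝕜) :
    ∫ x : ι' → X, F (fun i => x (e i)) ∂Measure.pi (fun _ => μ) =
      ∫ y, F y ∂Measure.pi (fun _ => μ) :=
  (measurePreserving_comp_equiv e).integral_comp' F

theorem integrable_comp_equiv {ι ι' : Type*} [Fintype ι] [Fintype ι'] (e : ι ≃ ι')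
    {F : (ι → X) → 𝕜} (hF : Integrable F (Measure.pi fun _ => μ)) :
    Integrable (fun x : ι' → X => F fun i => x (e i)) (Measure.pi fun _ => μ) :=
  (measurePreserving_comp_equiv e).integrable_comp_of_integrable hF

variable {E : X → X → 𝕜} {C : ℝ}

theorem integrable_prod_mul_prod_kernel (hE : Measurable (Function.uncurry E))
    (hC : ∀ s t, ‖E s t‖ ≤ C) {φ : α ⊕ α → X → 𝕜} (hφ : ∀ j, Integrable (φ j) μ) :
    Integrable (fun x : α ⊕ α → X => (∏ k, φ k (x k)) * ∏ a, E (x (.inl a)) (x (.inr a)))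
      (Measure.pi fun _ => μ) := by
  refine (Integrable.fintype_prod hφ).mul_bdd (c := ∏ _a : α, C) ?_ (ae_of_all _ fun x => ?_)
  · refine Measurable.aestronglyMeasurable (Finset.measurable_prod _ fun a _ => ?_)
    exact hE.comp (f := fun x : α ⊕ α → X => (x (.inl a), x (.inr a))) (by fun_prop)
  · rw [norm_prod]
    exact prod_le_prod (fun _ _ => norm_nonneg _) fun _ _ => hC _ _

theorem integral_prod_mul_prod_kernel (hE : Measurable (Function.uncurry E))
    (hC : ∀ s t, ‖E s t‖ ≤ C) {φ : α ⊕ α → X → 𝕜} (hφ : ∀ j, Integrable (φ j) μ) :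
    ∫ x : α ⊕ α → X, (∏ k, φ k (x k)) * ∏ a, E (x (.inl a)) (x (.inr a))
      ∂Measure.pi (fun _ => μ) =
    ∏ a, gramMatrix μ E φ (.inl a) (.inr a) := by
  have hmp := measurePreserving_sumPiEquivProdPi_symm (X := fun _ : α ⊕ α => X) fun _ => μ
  have hint := hmp.integrable_comp_of_integrable (integrable_prod_mul_prod_kernel hE hC hφ)
  simp only [Function.comp_def] at hint
  simp only [gramMatrix, of_apply]
  rw [← hmp.integral_comp', integral_prod _ hint, ← integral_fintype_prod_eq_prod]
  refine integral_congr_ae (ae_of_all _ fun y => ?_)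
  simp only [integralOp]
  rw [prod_mul_distrib, ← integral_fintype_prod_eq_prod (fun a t => E (y a) t * φ (.inr a) t),
    ← integral_const_mul]
  refine integral_congr_ae (ae_of_all _ fun z => ?_)
  simp only [Fintype.prod_sum_type, prod_mul_distrib]
  change (∏ a, φ (.inl a) (y a)) * (∏ a, φ (.inr a) (z a)) * ∏ a, E (y a) (z a) = _
  ring

variable [DecidableEq α]

theorem integrable_det_mul_prod_kernel (hE : Measurable (Function.uncurry E))
    (hC : ∀ s t, ‖E s t‖ ≤ C) {φ : α ⊕ α → X → 𝕜} (hφ : ∀ j, Integrable (φ j) μ) :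
    Integrable (fun x : α ⊕ α → X => (of fun i j => φ j (x i)).det *
      ∏ a, E (x (.inl a)) (x (.inr a))) (Measure.pi fun _ => μ) := by
  simp_rw [det_mul_prod_kernel_eq]
  exact integrable_finsetSum _ fun σ _ =>
    (integrable_prod_mul_prod_kernel hE hC fun j => hφ (σ j)).const_mul _

theorem integral_det_mul_prod_kernel (hE : Measurable (Function.uncurry E))
    (hC : ∀ s t, ‖E s t‖ ≤ C) {φ : α ⊕ α → X → 𝕜} (hφ : ∀ j, Integrable (φ j) μ) :
    ∫ x : α ⊕ α → X, (of fun i j => φ j (x i)).det *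
      ∏ a, E (x (.inl a)) (x (.inr a)) ∂Measure.pi (fun _ => μ) =
    pfaffianSum (gramMatrix μ E φ) := by
  simp_rw [det_mul_prod_kernel_eq]
  rw [integral_finsetSum _ fun σ _ =>
    (integrable_prod_mul_prod_kernel hE hC fun j => hφ (σ j)).const_mul _]
  refine sum_congr rfl fun σ _ => ?_
  rw [integral_const_mul, integral_prod_mul_prod_kernel hE hC fun j => hφ (σ j)]
  rfl

theorem integral_det_mul_pfaffianSum (hE : Measurable (Function.uncurry E))
    (hC : ∀ s t, ‖E s t‖ ≤ C) {φ : α ⊕ α → X → 𝕜} (hφ : ∀ j, Integrable (φ j) μ) :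
    ∫ x : α ⊕ α → X, (of fun i j => φ j (x i)).det *
      pfaffianSum (of fun k l => E (x k) (x l)) ∂Measure.pi (fun _ => μ) =
    (Fintype.card (α ⊕ α)).factorial * pfaffianSum (gramMatrix μ E φ) := by
  simp_rw [det_mul_pfaffianSum_kernel_eq]
  rw [integral_finsetSum _ fun τ _ =>
    integrable_comp_equiv τ (integrable_det_mul_prod_kernel hE hC hφ)]
  rw [sum_congr rfl fun τ _ => (integral_comp_equiv τ fun x =>
    (of fun i j => φ j (x i)).det * ∏ a, E (x (.inl a)) (x (.inr a))).trans
    (integral_det_mul_prod_kernel hE hC hφ)]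
  rw [sum_const, card_univ, Fintype.card_perm, nsmul_eq_mul]

end DeBruijn

section SumOfMinors

open Matrix Finset

variable {ι : Type*} [DecidableEq ι]

theorem sum_injective_image_eq_eq_sum_equiv [Fintype ι] {M : Type*} [AddCommMonoid M] {n : ℕ}
    (s : Finset ι) (F : (Fin n → ι) → M) :
    ∑ κ : Fin n → ι with Function.Injective κ ∧ univ.image κ = s, F κ =
      ∑ e : Fin n ≃ s, F fun i => e i := by
  symm
  refine sum_bij (fun e _ => fun i => (e i : ι)) (fun e _ => ?_) (fun e _ e' _ h => ?_)
    (fun κ hκ => ?_) fun _ _ => rfl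
  · rw [mem_filter]
    refine ⟨mem_univ _, Subtype.val_injective.comp e.injective, ?_⟩
    ext x
    simp only [mem_image, mem_univ, true_and]
    exact ⟨fun ⟨i, hi⟩ => hi ▸ (e i).2, fun hx => ⟨e.symm ⟨x, hx⟩, by simp⟩⟩
  · exact Equiv.ext fun i => Subtype.ext (congrFun h i)
  · obtain ⟨hinj, himg⟩ := (mem_filter.1 hκ).2
    have hmem (i : Fin n) : κ i ∈ s := himg ▸ mem_image_of_mem _ (mem_univ i)
    refine ⟨Equiv.ofBijective (fun i => ⟨κ i, hmem i⟩)
      ⟨fun i j hij => hinj (congrArg Subtype.val hij), fun x => ?_⟩, mem_univ _, rfl⟩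
    obtain ⟨i, -, hi⟩ := mem_image.1 (himg.symm ▸ x.2 : (x : ι) ∈ univ.image κ)
    exact ⟨i, Subtype.ext hi⟩

variable {R : Type*} [CommRing R]

theorem sum_equiv_det_submatrix (G : Matrix ι ι R) {n : ℕ} {s : Finset ι} (hs : #s = n) :
    ∑ e : Fin n ≃ s, (G.submatrix (fun i => (e i : ι)) fun i => (e i : ι)).det =
      n.factorial * (G.submatrix (Subtype.val : s → ι) Subtype.val).det := by
  have hdet (e : Fin n ≃ s) : (G.submatrix (fun i => (e i : ι)) fun i => (e i : ι)).det =
      (G.submatrix (Subtype.val : s → ι) Subtype.val).det :=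
    det_submatrix_equiv_self e (G.submatrix (Subtype.val : s → ι) Subtype.val)
  rw [sum_congr rfl fun e _ => hdet e, sum_const, card_univ,
    Fintype.card_equiv (s.equivFinOfCardEq hs).symm, Fintype.card_fin, nsmul_eq_mul]

variable [Fintype ι]

theorem sum_det_submatrix (G : Matrix ι ι R) (n : ℕ) :
    ∑ κ : Fin n → ι, (G.submatrix κ κ).det =
      n.factorial * (det (1 + (Polynomial.X : Polynomial R) • G.map Polynomial.C)).coeff n := by
  have h_not_injective : ∑ κ : Fin n → ι with ¬ Function.Injective κ,
      (G.submatrix κ κ).det = 0 := by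
    refine sum_eq_zero fun κ hκ => ?_
    obtain ⟨i, j, hij, hne⟩ := Function.not_injective_iff.1 (mem_filter.1 hκ).2
    exact det_zero_of_column_eq hne fun k => by simp [hij]
  have h_image : ∀ κ ∈ (univ : Finset (Fin n → ι)).filter Function.Injective,
      univ.image κ ∈ (univ : Finset ι).powersetCard n := fun κ hκ =>
    mem_powersetCard.2
      ⟨subset_univ _, by rw [card_image_of_injective _ (mem_filter.1 hκ).2, card_fin]⟩
  rw [← sum_filter_add_sum_filter_not univ Function.Injective, h_not_injective, add_zero,
    ← sum_fiberwise_of_maps_to h_image, coeff_det_one_add_X_smul_eq_sum_minors, mul_sum]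
  refine sum_congr rfl fun s hs => ?_
  rw [filter_filter, sum_injective_image_eq_eq_sum_equiv s fun κ => (G.submatrix κ κ).det,
    sum_equiv_det_submatrix G (mem_powersetCard.1 hs).2]

theorem det_one_add_eq_eval_one (G : Matrix ι ι R) :
    (1 + G).det =
      (det (1 + (Polynomial.X : Polynomial R) • G.map Polynomial.C)).eval 1 := by
  rw [← Polynomial.coe_evalRingHom, RingHom.map_det]
  congr 1
  ext i j
  simp [Matrix.one_apply, apply_ite (Polynomial.eval (1 : R))]

theorem hasSum_sum_det_submatrix {𝕜 : Type*} [RCLike 𝕜] (G : Matrix ι ι 𝕜) :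
    HasSum (fun n : ℕ => (n.factorial : 𝕜)⁻¹ * ∑ κ : Fin n → ι, (G.submatrix κ κ).det)
      (1 + G).det := by
  have hterm (n : ℕ) : (n.factorial : 𝕜)⁻¹ * ∑ κ : Fin n → ι, (G.submatrix κ κ).det =
      (det (1 + (Polynomial.X : Polynomial 𝕜) • G.map Polynomial.C)).coeff n := by
    rw [sum_det_submatrix, inv_mul_cancel_left₀ (Nat.cast_ne_zero.2 n.factorial_ne_zero)]
  rw [funext hterm, det_one_add_eq_eval_one G, Polynomial.eval_eq_sum, Polynomial.sum]
  simp only [one_pow, mul_one]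
  exact hasSum_sum_of_ne_finset_zero fun n hn => Polynomial.notMem_support_iff.1 hn

end SumOfMinors

section Fredholm

open MeasureTheory Matrix Equiv Finset

theorem restrict_cube (I : Set ℝ) (n : ℕ) :
    (volume : Measure (Fin n → ℝ)).restrict (cube I n) =
      Measure.pi fun _ => volume.restrict I := by
  rw [cube, volume_pi, Measure.restrict_pi_pi]

variable {ι X 𝕜 : Type*} [Fintype ι] [RCLike 𝕜]

theorem det_finiteRank_eq (a b : ι → X → 𝕜) {n : ℕ} (x : Fin n → X) :
    (of fun i j => ∑ k, a k (x i) * b k (x j)).det =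
      ∑ κ : Fin n → ι, ∑ σ : Perm (Fin n), ((Perm.sign σ : ℤ) : 𝕜) *
        ∏ i, (b (κ i) (x i) * a (κ (σ i)) (x i)) := by
  rw [det_apply', sum_comm]
  refine Fintype.sum_equiv (Equiv.inv (Perm (Fin n))) _ _ fun σ => ?_
  rw [← mul_sum]
  simp only [Equiv.inv_apply, Perm.sign_inv, of_apply]
  rw [prod_univ_sum, Fintype.piFinset_univ]
  congr 1
  refine sum_congr rfl fun κ _ => ?_
  rw [prod_mul_distrib, prod_mul_distrib, mul_comm,
    ← Equiv.prod_comp σ fun i => a (κ (σ⁻¹ i)) (x i)]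
  simp only [Perm.coe_inv, symm_apply_apply]

variable [MeasurableSpace X] {μ : Measure X} [SigmaFinite μ] {a b : ι → X → 𝕜}

theorem integrable_det_finiteRank (hab : ∀ i j, Integrable (fun x => b i x * a j x) μ) (n : ℕ) :
    Integrable (fun x : Fin n → X => (of fun i j => ∑ k, a k (x i) * b k (x j)).det)
      (Measure.pi fun _ => μ) := by
  simp_rw [det_finiteRank_eq]
  exact integrable_finsetSum _ fun κ _ => integrable_finsetSum _ fun σ _ =>
    (Integrable.fintype_prod (f := fun i x => b (κ i) x * a (κ (σ i)) x)
      fun i => hab _ _).const_mul _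

theorem integral_det_finiteRank (hab : ∀ i j, Integrable (fun x => b i x * a j x) μ) (n : ℕ) :
    ∫ x : Fin n → X, (of fun i j => ∑ k, a k (x i) * b k (x j)).det
      ∂Measure.pi (fun _ => μ) =
    ∑ κ : Fin n → ι, ((of fun i j => ∫ x, b i x * a j x ∂μ).submatrix κ κ).det := by
  simp_rw [det_finiteRank_eq]
  have hint (κ : Fin n → ι) (σ : Perm (Fin n)) : Integrable (fun x : Fin n → X =>
      ((Perm.sign σ : ℤ) : 𝕜) * ∏ i, (b (κ i) (x i) * a (κ (σ i)) (x i)))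
      (Measure.pi fun _ => μ) :=
    (Integrable.fintype_prod (f := fun i x => b (κ i) x * a (κ (σ i)) x)
      fun i => hab _ _).const_mul _
  rw [integral_finsetSum _ fun κ _ => integrable_finsetSum _ fun σ _ => hint κ σ]
  refine sum_congr rfl fun κ _ => ?_
  rw [integral_finsetSum _ fun σ _ => hint κ σ, ← det_transpose, det_apply']
  refine sum_congr rfl fun σ _ => ?_
  rw [integral_const_mul,
    integral_fintype_prod_eq_prod fun i x => b (κ i) x * a (κ (σ i)) x]
  rfl

theorem isFredholmDet_finiteRank [DecidableEq ι] {I : Set ℝ} {a b : ι → ℝ → 𝕜}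
    (hab : ∀ i j, IntegrableOn (fun x => b i x * a j x) I) :
    IsFredholmDet I (fun x y => ∑ k, a k x * b k y)
      (1 + of fun i j => ∫ x in I, b i x * a j x).det := by
  refine ⟨fun n => ?_, ?_⟩
  · rw [IntegrableOn, restrict_cube]
    exact integrable_det_finiteRank hab n
  · simp_rw [restrict_cube, integral_det_finiteRank hab]
    exact hasSum_sum_det_submatrix _

end Fredholm

section SkewKernel

open MeasureTheory Matrix

variable {𝕜 X : Type*} [RCLike 𝕜] [MeasurableSpace X] {μ : Measure X}
  {E : X → X → 𝕜} {C : ℝ} {g h : X → 𝕜}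

theorem integrable_kernel_mul (hE : Measurable (Function.uncurry E)) (hC : ∀ s t, ‖E s t‖ ≤ C)
    (hg : Integrable g μ) (x : X) : Integrable (fun t => E x t * g t) μ :=
  hg.bdd_mul hE.of_uncurry_left.aestronglyMeasurable (ae_of_all _ (hC x))

theorem integralOp_add (hE : Measurable (Function.uncurry E)) (hC : ∀ s t, ‖E s t‖ ≤ C)
    (hg : Integrable g μ) (hh : Integrable h μ) (x : X) :
    integralOp μ E (fun t => g t + h t) x = integralOp μ E g x + integralOp μ E h x := by
  simp only [integralOp, mul_add]
  exact integral_add (integrable_kernel_mul hE hC hg x) (integrable_kernel_mul hE hC hh x)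

theorem norm_integralOp_le (hE : Measurable (Function.uncurry E)) (hC : ∀ s t, ‖E s t‖ ≤ C)
    (hg : Integrable g μ) (x : X) : ‖integralOp μ E g x‖ ≤ C * ∫ t, ‖g t‖ ∂μ := by
  rw [← integral_const_mul]
  refine (norm_integral_le_integral_norm _).trans (integral_mono
    (integrable_kernel_mul hE hC hg x).norm (hg.norm.const_mul C) fun t => ?_)
  simp only [norm_mul]
  exact mul_le_mul_of_nonneg_right (hC x t) (norm_nonneg _)

theorem integral_mul_kernel (hskew : ∀ s t, E s t = -E t s) (g : X → 𝕜) (y : X) :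
    ∫ x, g x * E x y ∂μ = -integralOp μ E g y := by
  rw [integralOp, ← integral_neg]
  refine integral_congr_ae (ae_of_all _ fun x => ?_)
  simp only [hskew x y]
  ring

variable [SFinite μ]

theorem aestronglyMeasurable_integralOp (hE : Measurable (Function.uncurry E))
    (hg : AEStronglyMeasurable g μ) : AEStronglyMeasurable (integralOp μ E g) μ :=
  AEStronglyMeasurable.integral_prod_right' (f := fun p : X × X => E p.1 p.2 * g p.2)
    (hE.aestronglyMeasurable.mul hg.comp_snd)

theorem integrable_mul_integralOp (hE : Measurable (Function.uncurry E))
    (hC : ∀ s t, ‖E s t‖ ≤ C) (hg : Integrable g μ) (hh : Integrable h μ) :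
    Integrable (fun x => g x * integralOp μ E h x) μ :=
  hg.mul_bdd (aestronglyMeasurable_integralOp hE hh.aestronglyMeasurable)
    (ae_of_all _ (norm_integralOp_le hE hC hh))

theorem integral_mul_integralOp_eq_neg (hE : Measurable (Function.uncurry E))
    (hC : ∀ s t, ‖E s t‖ ≤ C) (hskew : ∀ s t, E s t = -E t s) (hg : Integrable g μ)
    (hh : Integrable h μ) :
    ∫ x, g x * integralOp μ E h x ∂μ = -∫ x, h x * integralOp μ E g x ∂μ := by
  have hint : Integrable (Function.uncurry fun x y => g x * (E x y * h y)) (μ.prod μ) :=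
    ((hg.mul_prod hh).bdd_mul hE.aestronglyMeasurable (ae_of_all _ fun p => hC p.1 p.2)).congr
      (ae_of_all _ fun p => mul_left_comm _ _ _)
  calc ∫ x, g x * integralOp μ E h x ∂μ
      = ∫ x, ∫ y, g x * (E x y * h y) ∂μ ∂μ := by simp_rw [integralOp, integral_const_mul]
    _ = ∫ y, ∫ x, g x * (E x y * h y) ∂μ ∂μ := integral_integral_swap hint
    _ = ∫ y, -(h y * integralOp μ E g y) ∂μ := by
      simp_rw [← mul_assoc, integral_mul_const, integral_mul_kernel hskew, neg_mul, mul_comm]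
    _ = -∫ x, h x * integralOp μ E g x ∂μ := integral_neg _

theorem gramMatrix_transpose {ι : Type*} {φ : ι → X → 𝕜} (hE : Measurable (Function.uncurry E))
    (hC : ∀ s t, ‖E s t‖ ≤ C) (hskew : ∀ s t, E s t = -E t s) (hφ : ∀ j, Integrable (φ j) μ) :
    (gramMatrix μ E φ)ᵀ = -gramMatrix μ E φ := by
  ext j k
  exact integral_mul_integralOp_eq_neg hE hC hskew (hφ k) (hφ j)

end SkewKernel

section Perturbation

open MeasureTheory

variable {𝕜 X : Type*} [RCLike 𝕜] [MeasurableSpace X]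

/-- The transpose of the operator `f ^ 2 + 2 f - E f' - f E f'`, for a skew-symmetric kernel `E`,
applied to `g`. -/
noncomputable def transposePerturbation (μ : Measure X) (E : X → X → 𝕜) (f f' g : X → 𝕜)
    (y : X) : 𝕜 :=
  (f y ^ 2 + 2 * f y) * g y + f' y * integralOp μ E g y +
    f' y * integralOp μ E (fun t => f t * g t) y

variable {μ : Measure X} {E : X → X → 𝕜} {C D : ℝ} {f f' g h : X → 𝕜}

theorem integrable_mul_one_add (hf : AEStronglyMeasurable f μ) (hD : ∀ x, ‖f x‖ ≤ D)
    (hg : Integrable g μ) : Integrable (fun x => g x * (1 + f x)) μ := by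
  simp_rw [mul_one_add, mul_comm (g _)]
  exact hg.add (hg.bdd_mul hf (ae_of_all _ hD))

variable [SFinite μ]

theorem integrable_transposePerturbation (hE : Measurable (Function.uncurry E))
    (hC : ∀ s t, ‖E s t‖ ≤ C) (hf : AEStronglyMeasurable f μ) (hD : ∀ x, ‖f x‖ ≤ D)
    (hf' : Integrable f' μ) (hg : Integrable g μ) :
    Integrable (transposePerturbation μ E f f' g) μ := by
  have hfg : Integrable (fun x => f x * g x) μ := hg.bdd_mul hf (ae_of_all _ hD)
  have hffg : Integrable (fun x => f x * (f x * g x)) μ := hfg.bdd_mul hf (ae_of_all _ hD)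
  have hquad : Integrable (fun x => (f x ^ 2 + 2 * f x) * g x) μ :=
    (hffg.add (hfg.const_mul 2)).congr
      (ae_of_all _ fun x => by simp only [Pi.add_apply]; ring)
  exact (hquad.add (integrable_mul_integralOp hE hC hf' hg)).add
    (integrable_mul_integralOp hE hC hf' hfg)

/-- The right factor `1 + f` is moved through `E` by `hcomm`, which says `[f, E] = E f' E`. -/
theorem integral_mul_one_add_mul_integralOp (hE : Measurable (Function.uncurry E))
    (hC : ∀ s t, ‖E s t‖ ≤ C) (hskew : ∀ s t, E s t = -E t s)
    (hf : AEStronglyMeasurable f μ) (hD : ∀ x, ‖f x‖ ≤ D) (hf' : Integrable f' μ)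
    (hg : Integrable g μ) (hh : Integrable h μ)
    (hcomm : ∀ᵐ x ∂μ, integralOp μ E (fun t => f t * h t) x =
      f x * integralOp μ E h x - integralOp μ E (fun t => f' t * integralOp μ E h t) x) :
    ∫ x, g x * (1 + f x) * integralOp μ E (fun t => h t * (1 + f t)) x ∂μ =
      (∫ x, g x * integralOp μ E h x ∂μ) +
        ∫ x, transposePerturbation μ E f f' g x * integralOp μ E h x ∂μ := by
  have hop {u : X → 𝕜} (hu : Integrable u μ) (x : X) :
      integralOp μ E (fun t => u t * (1 + f t)) x =
        integralOp μ E u x + integralOp μ E (fun t => f t * u t) x := by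
    simp_rw [mul_one_add, mul_comm (u _)]
    exact integralOp_add hE hC hu (hu.bdd_mul hf (ae_of_all _ hD)) x
  have hu := integrable_mul_one_add hf hD hg
  have hu' := integrable_mul_one_add hf hD hu
  have hfh := integrable_mul_integralOp hE hC hf' hh
  have hrest : Integrable (fun x => f' x * integralOp μ E h x *
      integralOp μ E (fun t => g t * (1 + f t)) x) μ := integrable_mul_integralOp hE hC hfh hu
  calc ∫ x, g x * (1 + f x) * integralOp μ E (fun t => h t * (1 + f t)) x ∂μ
      = ∫ x, (g x * (1 + f x) * (1 + f x) * integralOp μ E h x - g x * (1 + f x) *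
          integralOp μ E (fun t => f' t * integralOp μ E h t) x) ∂μ := by
        refine integral_congr_ae ?_
        filter_upwards [hcomm] with x hx
        rw [hop hh, hx]
        ring
    _ = (∫ x, g x * (1 + f x) * (1 + f x) * integralOp μ E h x ∂μ) + ∫ x,
          f' x * integralOp μ E h x * integralOp μ E (fun t => g t * (1 + f t)) x ∂μ := by
        rw [integral_sub (integrable_mul_integralOp hE hC hu' hh)
          (integrable_mul_integralOp hE hC hu hfh),
          integral_mul_integralOp_eq_neg hE hC hskew hu hfh, sub_neg_eq_add]
    _ = _ := by
        rw [← integral_add (integrable_mul_integralOp hE hC hu' hh) hrest,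
          ← integral_add (integrable_mul_integralOp hE hC hg hh) (integrable_mul_integralOp hE hC
            (integrable_transposePerturbation hE hC hf hD hf' hg) hh)]
        refine integral_congr_ae (ae_of_all _ fun x => ?_)
        simp only [transposePerturbation, hop hg]
        ring

end Perturbation

section Calculus

open MeasureTheory Set Filter Topology

variable {𝕜 : Type*} [RCLike 𝕜]

theorem measurable_sign : Measurable Real.sign :=
  Measurable.ite measurableSet_Iio measurable_const
    (Measurable.ite measurableSet_Ioi measurable_const measurable_const)

theorem abs_sign_le_one (r : ℝ) : |Real.sign r| ≤ 1 := by
  rcases Real.sign_apply_eq r with h | h | h <;> rw [h] <;> norm_num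

theorem measurable_epsKernel : Measurable (Function.uncurry (epsKernel : ℝ → ℝ → 𝕜)) :=
  RCLike.measurable_ofReal.comp
    ((measurable_sign.comp (measurable_fst.sub measurable_snd)).div_const 2)

theorem norm_epsKernel_le (x y : ℝ) : ‖(epsKernel x y : 𝕜)‖ ≤ 1 := by
  rw [epsKernel, RCLike.norm_ofReal, abs_div, abs_two]
  linarith [abs_sign_le_one (x - y)]

theorem ordConnected_interval (a b : EReal) : (interval a b).OrdConnected :=
  ⟨fun _ hx _ hy _ hz => ⟨hx.1.trans (EReal.coe_le_coe_iff.2 hz.1),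
    (EReal.coe_le_coe_iff.2 hz.2).trans hy.2⟩⟩

theorem measurableSet_interval (a b : EReal) : MeasurableSet (interval a b) :=
  (ordConnected_interval a b).measurableSet

variable {f : ℝ → 𝕜}

theorem exists_norm_le_of_tendsto_cocompact (hf : Continuous f)
    (hf₀ : Tendsto f (cocompact ℝ) (𝓝 0)) : ∃ D, ∀ x, ‖f x‖ ≤ D :=
  let f₀ : ZeroAtInftyContinuousMap ℝ 𝕜 := ⟨⟨f, hf⟩, hf₀⟩
  ⟨‖f₀.toBCF‖, f₀.toBCF.norm_coe_le_norm⟩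

theorem setIntegral_deriv_Ioc (hf : Differentiable ℝ f) (hf' : Integrable (deriv f)) {x y : ℝ}
    (h : x ≤ y) : ∫ z in Ioc x y, deriv f z = f y - f x := by
  rw [← intervalIntegral.integral_of_le h]
  exact intervalIntegral.integral_eq_sub_of_hasDerivAt (fun z _ => (hf z).hasDerivAt)
    hf'.intervalIntegrable

theorem setIntegral_deriv_interval (hf : Differentiable ℝ f) (hf' : Integrable (deriv f))
    (hf₀ : Tendsto f (cocompact ℝ) (𝓝 0)) {a b : EReal} (hab : a < b) :
    ∫ x in interval a b, deriv f x = endValue f b - endValue f a := by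
  have hd (x : ℝ) : HasDerivAt f (deriv f x) x := (hf x).hasDerivAt
  have h_top : Tendsto f atTop (𝓝 0) := hf₀.mono_left _root_.atTop_le_cocompact
  have h_bot : Tendsto f atBot (𝓝 0) := hf₀.mono_left _root_.atBot_le_cocompact
  induction a with
  | top => exact absurd hab not_top_lt
  | bot =>
    induction b with
    | bot => exact absurd hab (lt_irrefl _)
    | top =>
      have : interval ⊥ ⊤ = univ := by ext; simp [interval]
      rw [this, setIntegral_univ, integral_of_hasDerivAt_of_tendsto hd hf' h_bot h_top]
      simp [endValue]
    | coe b =>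
      have : interval ⊥ b = Iic b := by ext; simp [interval]
      rw [this, integral_Iic_of_hasDerivAt_of_tendsto' (fun x _ => hd x) hf'.integrableOn h_bot]
      simp [endValue]
  | coe a =>
    induction b with
    | bot => exact absurd hab not_lt_bot
    | top =>
      have : interval a ⊤ = Ici a := by ext; simp [interval]
      rw [this, integral_Ici_eq_integral_Ioi,
        integral_Ioi_of_hasDerivAt_of_tendsto' (fun x _ => hd x) hf'.integrableOn h_top]
      simp [endValue]
    | coe b =>
      have : interval a b = Icc a b := by ext; simp [interval]
      rw [this, integral_Icc_eq_integral_Ioc,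
        setIntegral_deriv_Ioc hf hf' (EReal.coe_lt_coe_iff.1 hab).le]
      simp [endValue]

theorem epsKernel_mul_epsKernel {x y z : ℝ} (hyx : y ≤ x) (hzx : z ≠ x) (hzy : z ≠ y) (c : 𝕜) :
    epsKernel x z * (c * epsKernel z y) =
      -(1 / 4) * c + (1 / 2) * (Ioc y x).indicator (fun _ => c) z := by
  rcases hzx.lt_or_gt with hzx | hxz
  · rcases hzy.lt_or_gt with hzy | hyz
    · rw [indicator_of_notMem fun h => hzy.not_gt h.1, epsKernel_of_gt hzx, epsKernel_of_lt hzy]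
      ring
    · rw [indicator_of_mem (show z ∈ Ioc y x from ⟨hyz, hzx.le⟩), epsKernel_of_gt hzx,
        epsKernel_of_gt hyz]
      ring
  · rw [indicator_of_notMem fun h => hxz.not_ge h.2, epsKernel_of_lt hxz,
      epsKernel_of_gt (hyx.trans_lt hxz)]
    ring

theorem integral_epsKernel_mul_deriv_mul_epsKernel_of_le {I : Set ℝ} (hI : I.OrdConnected)
    (hf : Differentiable ℝ f) (hf' : Integrable (deriv f)) (hf'I : ∫ x in I, deriv f x = 0)
    {x y : ℝ} (hx : x ∈ I) (hy : y ∈ I) (hyx : y ≤ x) :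
    ∫ z in I, epsKernel x z * (deriv f z * epsKernel z y) = (1 / 2) * (f x - f y) := by
  have hae : ∀ᵐ z ∂volume.restrict I, epsKernel x z * (deriv f z * epsKernel z y) =
      -(1 / 4) * deriv f z + (1 / 2) * (Ioc y x).indicator (deriv f) z := by
    refine ae_restrict_of_ae ?_
    filter_upwards [compl_mem_ae_iff.2 (measure_singleton x),
      compl_mem_ae_iff.2 (measure_singleton y)] with z hzx hzy
    exact epsKernel_mul_epsKernel hyx hzx hzy _
  have hsub : Ioc y x ⊆ I := Ioc_subset_Icc_self.trans (hI.out hy hx)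
  rw [integral_congr_ae hae, integral_add (hf'.integrableOn.const_mul _)
    ((hf'.indicator measurableSet_Ioc).integrableOn.const_mul _), integral_const_mul,
    integral_const_mul, hf'I, setIntegral_indicator measurableSet_Ioc,
    inter_eq_self_of_subset_right hsub, setIntegral_deriv_Ioc hf hf' hyx, mul_zero, zero_add]

theorem integral_epsKernel_mul_deriv_mul_epsKernel {I : Set ℝ} (hI : I.OrdConnected)
    (hf : Differentiable ℝ f) (hf' : Integrable (deriv f)) (hf'I : ∫ x in I, deriv f x = 0)
    {x y : ℝ} (hx : x ∈ I) (hy : y ∈ I) :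
    ∫ z in I, epsKernel x z * (deriv f z * epsKernel z y) = (f x - f y) * epsKernel x y := by
  rcases lt_trichotomy y x with h | rfl | h
  · rw [integral_epsKernel_mul_deriv_mul_epsKernel_of_le hI hf hf' hf'I hx hy h.le,
      epsKernel_of_gt h, mul_comm]
  · rw [integral_epsKernel_mul_deriv_mul_epsKernel_of_le hI hf hf' hf'I hx hy le_rfl, sub_self,
      mul_zero, zero_mul]
  · have h_swap (z : ℝ) : epsKernel x z * (deriv f z * epsKernel z y) =
        epsKernel y z * (deriv f z * epsKernel z x) := by
      rw [epsKernel_eq_neg_swap x, epsKernel_eq_neg_swap z y]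
      ring
    simp_rw [h_swap]
    rw [integral_epsKernel_mul_deriv_mul_epsKernel_of_le hI hf hf' hf'I hy hx h.le,
      epsKernel_of_lt h]
    ring

theorem eps_mul_eq {I : Set ℝ} (hI : I.OrdConnected) (hf : Differentiable ℝ f)
    (hf' : Integrable (deriv f)) (hf'I : ∫ x in I, deriv f x = 0) {D : ℝ} (hD : ∀ x, ‖f x‖ ≤ D)
    {h : ℝ → 𝕜} (hh : IntegrableOn h I) {x : ℝ} (hx : x ∈ I) :
    eps I (fun t => f t * h t) x = f x * eps I h x - eps I (fun t => deriv f t * eps I h t) x := by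
  have hfh : IntegrableOn (fun t => f t * h t) I :=
    hh.bdd_mul hf.continuous.aestronglyMeasurable (ae_of_all _ hD)
  have hεf' : IntegrableOn (fun z => epsKernel x z * deriv f z) I :=
    integrable_kernel_mul measurable_epsKernel norm_epsKernel_le hf'.integrableOn x
  rw [eq_sub_iff_add_eq, ← eq_sub_iff_add_eq']
  calc eps I (fun t => deriv f t * eps I h t) x
      = ∫ z in I, (epsKernel x z * deriv f z) * eps I h z := by simp_rw [eps, mul_assoc]
    _ = ∫ y in I, -(h y * eps I (fun z => epsKernel x z * deriv f z) y) := by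
      rw [integral_neg]
      exact integral_mul_integralOp_eq_neg measurable_epsKernel norm_epsKernel_le
        epsKernel_eq_neg_swap hεf' hh
    _ = ∫ y in I, (f x * (epsKernel x y * h y) - epsKernel x y * (f y * h y)) := by
      refine setIntegral_congr_fun hI.measurableSet fun y hy => ?_
      have hy' : -eps I (fun z => epsKernel x z * deriv f z) y = (f x - f y) * epsKernel x y := by
        rw [← integral_epsKernel_mul_deriv_mul_epsKernel hI hf hf' hf'I hx hy]
        simp_rw [← mul_assoc]
        exact (integral_mul_kernel epsKernel_eq_neg_swap _ _).symm
      simp only [← mul_neg, hy']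
      ring
    _ = f x * eps I h x - eps I (fun t => f t * h t) x := by
      rw [eps, eps, ← integral_const_mul]
      exact integral_sub
        ((integrable_kernel_mul measurable_epsKernel norm_epsKernel_le hh x).const_mul _)
        (integrable_kernel_mul measurable_epsKernel norm_epsKernel_le hfh x)

end Calculus

section EnsembleIntegral

open MeasureTheory Matrix Equiv Finset

variable {𝕜 : Type*} [RCLike 𝕜]

theorem ofReal_det_vandermonde {N : ℕ} (x : Fin N → ℝ) :
    ((vandermonde x).det : 𝕜) = (vandermonde fun i => (x i : 𝕜)).det := by
  simp only [det_vandermonde, RCLike.ofReal_prod, RCLike.ofReal_sub]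

theorem integrable_det_of_integrable {ι X : Type*} [Fintype ι] [DecidableEq ι]
    [MeasurableSpace X] {μ : Measure X} [SigmaFinite μ] {φ : ι → X → 𝕜}
    (hφ : ∀ j, Integrable (φ j) μ) :
    Integrable (fun x : ι → X => (of fun i j => φ j (x i)).det) (Measure.pi fun _ => μ) := by
  simp_rw [← det_transpose (of _), det_apply']
  exact integrable_finsetSum _ fun σ _ => (Integrable.fintype_prod fun i => hφ (σ i)).const_mul _

theorem integrable_abs_mul {X : Type*} [MeasurableSpace X] {μ : Measure X} {d : X → ℝ}
    {F : X → 𝕜} (hd : Measurable d) (hF : Integrable (fun x => (d x : 𝕜) * F x) μ) :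
    Integrable (fun x => ((|d x| : ℝ) : 𝕜) * F x) μ := by
  have hsign : Measurable fun x => ((Real.sign (d x) : ℝ) : 𝕜) :=
    RCLike.measurable_ofReal.comp (measurable_sign.comp hd)
  refine (hF.bdd_mul (c := 1) hsign.aestronglyMeasurable (ae_of_all _ fun x => ?_)).congr
    (ae_of_all _ fun x => ?_)
  · exact (RCLike.norm_ofReal _).trans_le (abs_sign_le_one _)
  · have habs : Real.sign (d x) * d x = |d x| := by
      rcases lt_trichotomy (d x) 0 with h | h | h
      · rw [Real.sign_of_neg h, abs_of_neg h, neg_one_mul]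
      · rw [h, mul_zero, abs_zero]
      · rw [Real.sign_of_pos h, abs_of_pos h, one_mul]
    simp only [← habs, RCLike.ofReal_mul, mul_assoc]

/-- The integral of `|Δ(x)| ∏ u(x_j)` over `N` points with respect to `μ`, where `Δ` is the
Vandermonde determinant: the partition function for a possibly complex-valued weight `u`. -/
noncomputable def ensembleIntegral (μ : Measure ℝ) (N : ℕ) (u : ℝ → 𝕜) : 𝕜 :=
  ∫ x : Fin N → ℝ, ((|(vandermonde x).det| : ℝ) : 𝕜) * ∏ j, u (x j) ∂Measure.pi fun _ => μ

variable {μ : Measure ℝ} {u : ℝ → 𝕜}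

theorem integrable_eval_mul (hu : ∀ n : ℕ, Integrable (fun x : ℝ => (x : 𝕜) ^ n * u x) μ)
    (q : Polynomial 𝕜) : Integrable (fun x : ℝ => q.eval (x : 𝕜) * u x) μ := by
  simp_rw [Polynomial.eval_eq_sum_range, sum_mul, mul_assoc]
  exact integrable_finsetSum _ fun n _ => (hu n).const_mul _

variable [SigmaFinite μ]

theorem integrable_abs_det_vandermonde_mul_prod
    (hu : ∀ n : ℕ, Integrable (fun x : ℝ => (x : 𝕜) ^ n * u x) μ) (N : ℕ) :
    Integrable (fun x : Fin N → ℝ => ((|(vandermonde x).det| : ℝ) : 𝕜) * ∏ j, u (x j))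
      (Measure.pi fun _ => μ) := by
  have hdet (x : Fin N → ℝ) : (of fun i j : Fin N => (x i : 𝕜) ^ (j : ℕ) * u (x i)).det =
      ((vandermonde x).det : 𝕜) * ∏ j, u (x j) := by
    rw [ofReal_det_vandermonde, mul_comm, ← det_mul_column]
    simp only [vandermonde_apply, mul_comm]
  have hmeas : Measurable fun x : Fin N → ℝ => (vandermonde x).det := by
    simp_rw [det_vandermonde]
    fun_prop
  refine integrable_abs_mul hmeas ?_
  simp_rw [← hdet]
  exact integrable_det_of_integrable fun j : Fin N => hu j

theorem orderPfaffian_mul_ensembleIntegral {n : ℕ} {p : Fin (n + n) → Polynomial 𝕜}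
    (hp : ∀ j, (p j).natDegree < n + n)
    (hu : ∀ j, Integrable (fun x : ℝ => (p j).eval (x : 𝕜) * u x) μ) :
    orderPfaffian 𝕜 n * (of fun k j : Fin (n + n) => (p j).coeff k).det *
      ensembleIntegral μ (n + n) u =
    (n + n).factorial * pfaffianSum ((gramMatrix μ epsKernel
      fun j x => (p j).eval (x : 𝕜) * u x).submatrix finSumFinEquiv finSumFinEquiv) := by
  have h := integral_det_mul_pfaffianSum measurable_epsKernel norm_epsKernel_le
    fun j : Fin n ⊕ Fin n => hu (finSumFinEquiv j)
  rw [← integral_comp_equiv finSumFinEquiv, Fintype.card_sum, Fintype.card_fin] at h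
  rw [ensembleIntegral, ← integral_const_mul]
  refine Eq.trans (integral_congr_ae (ae_of_all _ fun x => ?_)) h
  have hdet : (of fun i j : Fin n ⊕ Fin n => (p (finSumFinEquiv j)).eval
      (x (finSumFinEquiv i) : 𝕜) * u (x (finSumFinEquiv i))).det = (∏ j, u (x j)) *
        (((vandermonde x).det : 𝕜) * (of fun k j : Fin (n + n) => (p j).coeff k).det) := by
    rw [ofReal_det_vandermonde, ← det_eval_eq_det_vandermonde_mul_det_coeff hp, ← det_mul_column,
      ← det_submatrix_equiv_self finSumFinEquiv]
    congr 1
    ext i j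
    exact mul_comm _ _
  simp only [hdet]
  linear_combination -(∏ j, u (x j)) * (of fun k j : Fin (n + n) => (p j).coeff k).det *
    det_vandermonde_mul_pfaffianSum_epsKernel (𝕜 := 𝕜) x

theorem sq_orderPfaffian_mul_ensembleIntegral {n : ℕ} {p : Fin (n + n) → Polynomial 𝕜}
    (hp : ∀ j, (p j).natDegree < n + n)
    (hu : ∀ j, Integrable (fun x : ℝ => (p j).eval (x : 𝕜) * u x) μ) :
    (orderPfaffian 𝕜 n * (of fun k j : Fin (n + n) => (p j).coeff k).det *
      ensembleIntegral μ (n + n) u) ^ 2 =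
    ((n + n).factorial * pfaffianSum (J (Fin n) 𝕜)) ^ 2 *
      (gramMatrix μ epsKernel fun j x => (p j).eval (x : 𝕜) * u x).det := by
  rw [orderPfaffian_mul_ensembleIntegral hp hu, mul_pow, pfaffianSum_sq, det_submatrix_equiv_self,
    mul_pow, mul_assoc]
  rw [transpose_submatrix, gramMatrix_transpose measurable_epsKernel norm_epsKernel_le
    epsKernel_eq_neg_swap hu, submatrix_neg]
  rfl

theorem exists_ne_zero_ensembleIntegral_sq_eq_mul_det {N : ℕ} (hN : Even N)
    {p : Fin N → Polynomial 𝕜} (hp : ∀ j, (p j).natDegree < N) (hli : LinearIndependent 𝕜 p) :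
    ∃ κ : 𝕜, κ ≠ 0 ∧ ∀ u : ℝ → 𝕜,
      (∀ j, Integrable (fun x : ℝ => (p j).eval (x : 𝕜) * u x) μ) →
      ensembleIntegral μ N u ^ 2 =
        κ * (gramMatrix μ epsKernel fun j x => (p j).eval (x : 𝕜) * u x).det := by
  obtain ⟨n, rfl⟩ := hN
  set L := orderPfaffian 𝕜 n * (of fun k j : Fin (n + n) => (p j).coeff k).det with hL
  set c := (n + n).factorial * pfaffianSum (J (Fin n) 𝕜) with hc
  have hL₀ : L ≠ 0 := mul_ne_zero (orderPfaffian_ne_zero n) (det_coeff_ne_zero hp hli)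
  have hc₀ : c ≠ 0 :=
    mul_ne_zero (Nat.cast_ne_zero.2 (Nat.factorial_ne_zero _)) pfaffianSum_J_ne_zero
  refine ⟨(c / L) ^ 2, pow_ne_zero 2 (div_ne_zero hc₀ hL₀), fun u hu => ?_⟩
  have h := sq_orderPfaffian_mul_ensembleIntegral hp hu
  rw [← hL, ← hc] at h
  rw [div_pow, div_mul_eq_mul_div, ← h, mul_pow, mul_div_cancel_left₀ _ (pow_ne_zero 2 hL₀)]

end EnsembleIntegral

section Weight

open MeasureTheory Matrix Finset

variable {𝕜 : Type*} [RCLike 𝕜] {I : Set ℝ} {w : ℝ → ℝ}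

theorem IsWeight.integrable_pow_mul (hw : IsWeight I w) (n : ℕ) :
    IntegrableOn (fun x : ℝ => (x : 𝕜) ^ n * (w x : 𝕜)) I := by
  simpa only [RCLike.ofReal_mul, RCLike.ofReal_pow] using! (hw.moments n).ofReal (𝕜 := 𝕜)

theorem IsWeight.integrable_pow_mul_one_add (hw : IsWeight I w) {f : ℝ → 𝕜}
    (hf : AEStronglyMeasurable f (volume.restrict I)) {D : ℝ} (hD : ∀ x, ‖f x‖ ≤ D) (n : ℕ) :
    IntegrableOn (fun x : ℝ => (x : 𝕜) ^ n * ((w x : 𝕜) * (1 + f x))) I := by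
  simp_rw [← mul_assoc]
  exact integrable_mul_one_add hf hD (hw.integrable_pow_mul n)

theorem density_eq (w : ℝ → ℝ) (N : ℕ) (x : Fin N → ℝ) :
    density w N x = |(vandermonde x).det| * ∏ j, w (x j) := by
  rw [density, prod_abs_sub_eq_abs_det_vandermonde]

theorem genIntegrand_eq (w : ℝ → ℝ) (N : ℕ) (f : ℝ → 𝕜) (x : Fin N → ℝ) :
    genIntegrand w N f x =
      ((|(vandermonde x).det| : ℝ) : 𝕜) * ∏ j, ((w (x j) : 𝕜) * (1 + f (x j))) := by
  rw [genIntegrand, density_eq, prod_mul_distrib, RCLike.ofReal_mul, RCLike.ofReal_prod, mul_assoc]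

theorem integral_genIntegrand (I : Set ℝ) (w : ℝ → ℝ) (N : ℕ) (f : ℝ → 𝕜) :
    ∫ x in cube I N, genIntegrand w N f x =
      ensembleIntegral (volume.restrict I) N fun x => (w x : 𝕜) * (1 + f x) := by
  simp_rw [genIntegrand_eq, restrict_cube]
  rfl

theorem ofReal_partitionFunction (I : Set ℝ) (w : ℝ → ℝ) (N : ℕ) :
    (partitionFunction I w N : 𝕜) =
      ensembleIntegral (volume.restrict I) N fun x => (w x : 𝕜) := by
  rw [partitionFunction, ← integral_ofReal, restrict_cube, ensembleIntegral]
  simp_rw [density_eq, RCLike.ofReal_mul, RCLike.ofReal_prod]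

theorem IsWeight.integrable_genIntegrand (hw : IsWeight I w) (N : ℕ) {f : ℝ → 𝕜}
    (hf : AEStronglyMeasurable f (volume.restrict I)) {D : ℝ} (hD : ∀ x, ‖f x‖ ≤ D) :
    IntegrableOn (genIntegrand w N f) (cube I N) := by
  rw [funext (genIntegrand_eq w N f), IntegrableOn, restrict_cube]
  exact integrable_abs_det_vandermonde_mul_prod (hw.integrable_pow_mul_one_add hf hD) N

theorem IsWeight.integrable_density (hw : IsWeight I w) (N : ℕ) :
    IntegrableOn (density w N) (cube I N) := by
  rw [funext (density_eq w N), IntegrableOn, restrict_cube]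
  exact integrable_abs_det_vandermonde_mul_prod (𝕜 := ℝ) (hw.integrable_pow_mul (𝕜 := ℝ)) N

theorem ae_ne_of_ne {ι : Type*} [Fintype ι] {i j : ι} (hij : i ≠ j) :
    ∀ᵐ x : ι → ℝ, x i ≠ x j := by
  classical
  let V : Submodule ℝ (ι → ℝ) :=
    LinearMap.ker (LinearMap.proj (R := ℝ) (φ := fun _ : ι => ℝ) i - LinearMap.proj j)
  have hV : V ≠ ⊤ := by
    intro h
    have : Pi.single i (1 : ℝ) ∈ V := h ▸ Submodule.mem_top
    simp [V, hij.symm] at this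
  refine measure_mono_null (fun x hx => ?_) (Measure.addHaar_submodule volume V hV)
  have : x i = x j := not_ne_iff.1 hx
  simp [V, this]

theorem ae_injective (ι : Type*) [Fintype ι] : ∀ᵐ x : ι → ℝ, Function.Injective x := by
  have h : ∀ᵐ x : ι → ℝ, ∀ i j, i ≠ j → x i ≠ x j := by
    simp_rw [ae_all_iff]
    exact fun i j hij => ae_ne_of_ne hij
  filter_upwards [h] with x hx i j
  exact not_imp_not.1 (hx i j)

theorem IsWeight.measure_support_pos (hI : MeasurableSet I) (hw : IsWeight I w) :
    0 < volume.restrict I (Function.support w) := by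
  have hint : IntegrableOn w I := by simpa using hw.moments 0
  have hnonneg : 0 ≤ᵐ[volume.restrict I] w := by
    filter_upwards [ae_restrict_mem hI] with x hx using hw.nonneg x hx
  exact (integral_pos_iff_support_of_nonneg_ae hnonneg hint).1 hw.pos

theorem subsingleton_interval {a b : EReal} (hba : b ≤ a) : (interval a b).Subsingleton :=
  fun _ hx _ hy => EReal.coe_eq_coe_iff.1 <|
    le_antisymm (hx.2.trans (hba.trans hy.1)) (hy.2.trans (hba.trans hx.1))

theorem IsWeight.lt {a b : EReal} (hw : IsWeight (interval a b) w) : a < b := by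
  by_contra! hba
  refine hw.pos.ne' (setIntegral_measure_zero w ?_)
  exact (subsingleton_interval hba).measure_zero volume

theorem IsWeight.partitionFunction_pos (hI : MeasurableSet I) (hw : IsWeight I w) (N : ℕ) :
    0 < partitionFunction I w N := by
  have hnonneg : 0 ≤ᵐ[volume.restrict (cube I N)] density w N := by
    filter_upwards [ae_restrict_mem (MeasurableSet.univ_pi fun _ => hI)] with x hx
    rw [density_eq]
    exact mul_nonneg (abs_nonneg _) (prod_nonneg fun j _ => hw.nonneg _ (hx j trivial))
  rw [partitionFunction,
    integral_pos_iff_support_of_nonneg_ae hnonneg (hw.integrable_density N)]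
  have hpi : 0 < volume.restrict (cube I N) (Set.univ.pi fun _ => Function.support w) := by
    rw [restrict_cube, Measure.pi_pi]
    exact pos_iff_ne_zero.2 (prod_ne_zero_iff.2 fun _ _ => (hw.measure_support_pos hI).ne')
  refine hpi.trans_le (measure_mono_ae ?_)
  filter_upwards [ae_restrict_of_ae (ae_injective (Fin N))] with x hx hxw
  change density w N x ≠ 0
  rw [density_eq]
  exact mul_ne_zero (abs_ne_zero.2 (det_vandermonde_ne_zero_iff.2 hx))
    (prod_ne_zero_iff.2 fun j _ => hxw j trivial)

variable {N : ℕ} {p : Fin N → Polynomial 𝕜}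

theorem IsWeight.integrable_psi (hw : IsWeight I w) (p : Fin N → Polynomial 𝕜) (j : Fin N) :
    IntegrableOn (psi w p j) I :=
  integrable_eval_mul hw.integrable_pow_mul (p j)

theorem IsWeight.isUnit_momentMatrix (hI : MeasurableSet I) (hw : IsWeight I w) (hN : Even N)
    (hp : ∀ j, (p j).natDegree < N) (hli : LinearIndependent 𝕜 p) :
    IsUnit (momentMatrix I w p) := by
  obtain ⟨κ, -, hκ⟩ :=
    exists_ne_zero_ensembleIntegral_sq_eq_mul_det (μ := volume.restrict I) hN hp hli
  have hZ : κ * (momentMatrix I w p).det = (partitionFunction I w N : 𝕜) ^ 2 := by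
    rw [ofReal_partitionFunction]
    exact (hκ _ (hw.integrable_psi p)).symm
  have hZ₀ : (partitionFunction I w N : 𝕜) ≠ 0 :=
    RCLike.ofReal_ne_zero.2 (hw.partitionFunction_pos hI N).ne'
  exact (isUnit_iff_isUnit_det _).2
    (right_ne_zero_of_mul (hZ.trans_ne (pow_ne_zero 2 hZ₀))).isUnit

theorem IsWeight.genFun_sq (hw : IsWeight I w) (hN : Even N)
    (hp : ∀ j, (p j).natDegree < N) (hli : LinearIndependent 𝕜 p) {f : ℝ → 𝕜}
    (hf : AEStronglyMeasurable f (volume.restrict I)) {D : ℝ} (hD : ∀ x, ‖f x‖ ≤ D) :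
    genFun I w N f ^ 2 = (momentMatrix I w p).det⁻¹ *
      (gramMatrix (volume.restrict I) epsKernel fun j x => psi w p j x * (1 + f x)).det := by
  obtain ⟨κ, hκ₀, hκ⟩ :=
    exists_ne_zero_ensembleIntegral_sq_eq_mul_det (μ := volume.restrict I) hN hp hli
  have hden : (partitionFunction I w N : 𝕜) ^ 2 = κ * (momentMatrix I w p).det := by
    rw [ofReal_partitionFunction]
    exact hκ _ (hw.integrable_psi p)
  have hnum : (∫ x in cube I N, genIntegrand w N f x) ^ 2 = κ *
      (gramMatrix (volume.restrict I) epsKernel fun j x => psi w p j x * (1 + f x)).det := by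
    rw [integral_genIntegrand, hκ _ fun j =>
      integrable_eval_mul (hw.integrable_pow_mul_one_add hf hD) (p j)]
    simp only [psi, mul_assoc]
  rw [genFun, mul_pow, inv_pow, hden, hnum, _root_.mul_inv_rev, mul_assoc, inv_mul_cancel_left₀ hκ₀]

end Weight

section ScalarKernel

open MeasureTheory Matrix Finset

theorem det_inv_mul_det_add {R n : Type*} [Field R] [Fintype n] [DecidableEq n]
    {M : Matrix n n R} (hM : IsUnit M) (A : Matrix n n R) :
    M.det⁻¹ * (M + A).det = (1 + M⁻¹ * A).det := by
  have hdet := (isUnit_iff_isUnit_det _).1 hM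
  rw [← Ring.inverse_eq_inv', ← det_nonsing_inv, ← det_mul, mul_add, nonsing_inv_mul _ hdet]

variable {𝕜 : Type*} [RCLike 𝕜]

theorem integral_sum_mul_mul_eq_mul {ι X : Type*} [Fintype ι] [MeasurableSpace X]
    {μ : Measure X} {g h : ι → X → 𝕜} (hgh : ∀ i j, Integrable (fun x => g i x * h j x) μ)
    (B : Matrix ι ι 𝕜) :
    (of fun i j => ∫ x, (∑ k, B i k * g k x) * h j x ∂μ) =
      B * of fun i j => ∫ x, g i x * h j x ∂μ := by
  ext i j
  simp_rw [of_apply, sum_mul, mul_assoc]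
  rw [integral_finsetSum _ fun k _ => (hgh k j).const_mul _, mul_apply]
  exact sum_congr rfl fun k _ => integral_const_mul _ _

variable {I : Set ℝ} {w : ℝ → ℝ} {N : ℕ} {p : Fin N → Polynomial 𝕜} {f : ℝ → 𝕜} {D : ℝ}

theorem kernelComp_sum_epsKernel {g : Fin N → ℝ → 𝕜} (hg : ∀ k, IntegrableOn (g k) I)
    (c : Fin N → Fin N → ℝ → 𝕜) (x y : ℝ) :
    kernelComp I (fun x z => ∑ j, ∑ k, c j k x * g k z) epsKernel x y =
      ∑ j, ∑ k, c j k x * -eps I (g k) y := by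
  have hint (j k : Fin N) : IntegrableOn (fun z => c j k x * (g k z * epsKernel z y)) I :=
    ((hg k).mul_bdd measurable_epsKernel.of_uncurry_right.aestronglyMeasurable
      (ae_of_all _ fun z => norm_epsKernel_le z y)).const_mul _
  simp_rw [kernelComp, sum_mul, mul_assoc]
  rw [integral_finsetSum _ fun j _ => integrable_finsetSum _ fun k _ => hint j k]
  refine sum_congr rfl fun j _ => ?_
  rw [integral_finsetSum _ fun k _ => hint j k]
  refine sum_congr rfl fun k _ => ?_
  rw [integral_const_mul, integral_mul_kernel epsKernel_eq_neg_swap]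
  rfl

theorem scalarKernel_eq_sum (hψ : ∀ j, IntegrableOn (psi w p j) I)
    (hf : AEStronglyMeasurable f (volume.restrict I)) (hD : ∀ x, ‖f x‖ ≤ D) :
    scalarKernel I (kernel22 I w p) f = fun x y => ∑ j, eps I (psi w p j) x *
      ∑ k, (momentMatrix I w p)⁻¹ j k *
        transposePerturbation (volume.restrict I) epsKernel f (deriv f) (psi w p k) y := by
  have hfψ (k : Fin N) : IntegrableOn (fun t => f t * psi w p k t) I :=
    (hψ k).bdd_mul hf (ae_of_all _ hD)
  have hfK : kernelMul (kernel22 I w p) f = fun x z => ∑ j, ∑ k,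
      (momentMatrix I w p)⁻¹ j k * eps I (psi w p j) x * (f z * psi w p k z) := by
    ext x z
    simp only [kernelMul, kernel22, sum_mul, mul_assoc, mul_comm (f z)]
  ext x y
  have hKε : kernelComp I (kernel22 I w p) epsKernel x y = ∑ j, ∑ k,
      (momentMatrix I w p)⁻¹ j k * eps I (psi w p j) x * -eps I (psi w p k) y :=
    kernelComp_sum_epsKernel hψ (fun j k x => (momentMatrix I w p)⁻¹ j k * eps I (psi w p j) x) x y
  have hε (g : ℝ → 𝕜) : integralOp (volume.restrict I) epsKernel g = eps I g := rfl
  rw [scalarKernel, hfK, kernelMul, kernelMul, kernelMul, hKε, kernel22,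
    kernelComp_sum_epsKernel hfψ fun j k x => (momentMatrix I w p)⁻¹ j k * eps I (psi w p j) x]
  simp_rw [sum_mul, mul_sum, ← sum_sub_distrib]
  refine sum_congr rfl fun j _ => sum_congr rfl fun k _ => ?_
  simp only [transposePerturbation, hε]
  ring

theorem isFredholmDet_scalarKernel (hI : I.OrdConnected) (hψ : ∀ j, IntegrableOn (psi w p j) I)
    (hM : IsUnit (momentMatrix I w p)) (hf : Differentiable ℝ f) (hf' : Integrable (deriv f))
    (hf'I : ∫ x in I, deriv f x = 0) (hD : ∀ x, ‖f x‖ ≤ D) :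
    IsFredholmDet I (scalarKernel I (kernel22 I w p) f) ((momentMatrix I w p).det⁻¹ *
      (gramMatrix (volume.restrict I) epsKernel fun j x => psi w p j x * (1 + f x)).det) := by
  have hfm : AEStronglyMeasurable f (volume.restrict I) := hf.continuous.aestronglyMeasurable
  set r : Fin N → ℝ → 𝕜 := fun k =>
    transposePerturbation (volume.restrict I) epsKernel f (deriv f) (psi w p k)
  have hr (k j : Fin N) : IntegrableOn (fun x => r k x * eps I (psi w p j) x) I :=
    integrable_mul_integralOp measurable_epsKernel norm_epsKernel_le
      (integrable_transposePerturbation measurable_epsKernel norm_epsKernel_le hfm hD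
        hf'.integrableOn (hψ k)) (hψ j)
  have hgram : (gramMatrix (volume.restrict I) epsKernel fun j x => psi w p j x * (1 + f x)) =
      momentMatrix I w p + of fun k j => ∫ x in I, r k x * eps I (psi w p j) x := by
    ext j k
    refine integral_mul_one_add_mul_integralOp measurable_epsKernel norm_epsKernel_le
      epsKernel_eq_neg_swap hfm hD hf'.integrableOn (hψ j) (hψ k) ?_
    filter_upwards [ae_restrict_mem hI.measurableSet] with x hx
    exact eps_mul_eq hI hf hf' hf'I hD (hψ k) hx
  rw [hgram, det_inv_mul_det_add hM, ← integral_sum_mul_mul_eq_mul hr,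
    scalarKernel_eq_sum hψ hfm hD]
  refine isFredholmDet_finiteRank fun i j => ?_
  simp_rw [sum_mul, mul_assoc]
  exact integrable_finsetSum _ fun k _ => (hr k j).const_mul _

end ScalarKernel

end OrthogonalEnsemble

open OrthogonalEnsemble in
theorem mainTheorem6_general {𝕜 : Type*} [RCLike 𝕜] {a b : EReal} {w : ℝ → ℝ}
    (hw : IsWeight (interval a b) w) {N : ℕ} (hN : Even N) {p : Fin N → Polynomial 𝕜}
    (hp : ∀ j, (p j).natDegree < N) (hli : LinearIndependent 𝕜 p) {f : ℝ → 𝕜}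
    (hf : Differentiable ℝ f) (hf' : MeasureTheory.Integrable (deriv f))
    (hf₀ : Filter.Tendsto f (Filter.cocompact ℝ) (nhds 0)) (hfab : endValue f a = endValue f b) :
    0 < partitionFunction (interval a b) w N ∧
    MeasureTheory.IntegrableOn (genIntegrand w N f) (cube (interval a b) N) ∧
    IsUnit (momentMatrix (interval a b) w p) ∧
    IsFredholmDet (interval a b)
      (scalarKernel (interval a b) (kernel22 (interval a b) w p) f)
      (genFun (interval a b) w N f ^ 2) := by
  have hI := measurableSet_interval a b
  have hfm := hf.continuous.aestronglyMeasurable (μ := MeasureTheory.volume.restrict (interval a b))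
  have hf'I : ∫ x in interval a b, deriv f x = 0 := by
    rw [setIntegral_deriv_interval hf hf' hf₀ hw.lt, hfab, sub_self]
  have hM := hw.isUnit_momentMatrix hI hN hp hli
  obtain ⟨D, hD⟩ := exists_norm_le_of_tendsto_cocompact hf.continuous hf₀
  refine ⟨hw.partitionFunction_pos hI N, hw.integrable_genIntegrand N hfm hD, hM, ?_⟩
  rw [hw.genFun_sq hN hp hli hfm hD]
  exact isFredholmDet_scalarKernel (ordConnected_interval a b) (hw.integrable_psi p) hM hf hf'
    hf'I hD

theorem mainTheorem6 {𝕜 : Type*} [RCLike 𝕜] (a b : EReal) (w : ℝ → ℝ)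
    (hw : OrthogonalEnsemble.IsWeight (OrthogonalEnsemble.interval a b) w)
    (N : ℕ) (hN : Even N)
    (p : Fin N → Polynomial 𝕜) (hp : ∀ j : Fin N, (p j).degree = ((j : ℕ) : WithBot ℕ))
    (f : SchwartzMap ℝ 𝕜)
    (hf : OrthogonalEnsemble.endValue f a = OrthogonalEnsemble.endValue f b) :
    0 < OrthogonalEnsemble.partitionFunction (OrthogonalEnsemble.interval a b) w N ∧
    MeasureTheory.IntegrableOn (OrthogonalEnsemble.genIntegrand w N f)
      (OrthogonalEnsemble.cube (OrthogonalEnsemble.interval a b) N) ∧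
    IsUnit (OrthogonalEnsemble.momentMatrix (OrthogonalEnsemble.interval a b) w p) ∧
    OrthogonalEnsemble.IsFredholmDet (OrthogonalEnsemble.interval a b)
      (OrthogonalEnsemble.scalarKernel (OrthogonalEnsemble.interval a b)
        (OrthogonalEnsemble.kernel22 (OrthogonalEnsemble.interval a b) w p) f)
      (OrthogonalEnsemble.genFun (OrthogonalEnsemble.interval a b) w N f ^ 2) := by
  have hdeg (j : Fin N) := Polynomial.natDegree_eq_of_degree_eq_some (hp j)
  exact mainTheorem6_general hw hN (fun j => (hdeg j).trans_lt j.isLt)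
    (OrthogonalEnsemble.linearIndependent_of_degree_eq hp) f.differentiable
    (SchwartzMap.derivCLM ℝ 𝕜 f).integrable f.tendsto_cocompact hf
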